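/- Let $T,I,J\subseteq\mathbb R$ be nonempty open intervals for the variables $t,x,u$. Consider the class of equations $$f(x)\,u_{tt}=(g(x)H(u)u_x)_x+h(x)K(u)u_x,$$ whose arbitrary elements $\theta=(f,g,h,H,K)$ are smooth real functions ($f,g,h$ on $I$; $H,K$ on $J$) with $fgH\neq0$ everywhere and $(H_u,K_u)\not\equiv(0,0)$. An *extended equivalence transformation* of this class (or of a part $S$ of it) is a pair $(\Phi,\Theta)$: a nondegenerate (smooth, with nonvanishing Jacobian) point transformation $(\tilde t,\tilde x,\tilde u)=\Phi(t,x,u)$ on $T\times I\times J$, the same for all equations, and a rule $\Theta:\theta\mapsto\tilde\theta=(\tilde f,\tilde g,\tilde h,\tilde H,\tilde K)$ of any kind, possibly nonlocal, such that for every $\theta$ (in $S$) the tuple $\tilde\theta$ is again in the class (over the ranges of $\tilde x$ and $\tilde u$) and $\Phi$ transforms the equation with $\theta$ into the equation with $\tilde\theta$ (its second prolongation maps the first equation, as a set of 2-jets, to the second). Call $\theta$ *generic* if $h\not\equiv0$ on $I$ and $H,K$ are linearly independent on $J$. Call $\Theta$ *separated* if $(\tilde f,\tilde g,\tilde h)$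 is determined by $(f,g,h)$ and $(\tilde H,\tilde K)$ by $(H,K)$. **Theorem.** The extended equivalence group $\hat G^\sim$ of the class is formed by the transformations $$\tilde t=\delta_1t+\delta_2,\qquad \tilde x=X(x),\qquad \tilde u=\delta_3u+\delta_4,$$ $$\tilde f=\frac{\epsilon_1\delta_1^2}{X_x}\,f\,e^{-\epsilon_4\int\frac hg dx},\quad \tilde g=\epsilon_1\epsilon_2^{-1}X_x\,g\,e^{-\epsilon_4\int\frac hg dx},\quad \tilde h=\epsilon_1\epsilon_3^{-1}\,h\,e^{-\epsilon_4\int\frac hg dx},\quad \tilde H=\epsilon_2H,\quad \tilde K=\epsilon_3(K+\epsilon_4H),$$ where $\delta_1,\dots,\delta_4,\epsilon_1,\dots,\epsilon_4$ are constants with $\delta_1\delta_3\epsilon_1\epsilon_2\epsilon_3\ne0$, $X$ is a smooth function on $I$ with $X_x\ne0$, $\int\frac hg dx$ is an antiderivative of $h/g$ on $I$, and the left-hand sides of the formulas for $\tilde f,\tilde g,\tilde h$ are taken at $\tilde x=X(x)$, those for $\tilde H,\tilde K$ at $\tilde u=\delta_3u+\delta_4$. Precisely: 1. For all such parameters there is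 a separated rule $\Theta$ on the class given by these formulas, with the same constants for all $\theta$. 2. If $\Phi$ has the stated form on $T\times I\times J$ and, for every $\theta$ of the class, $\Theta\theta$ is given by the formulas with some admissible $\epsilon_1,\dots,\epsilon_4$ (possibly depending on $\theta$), then $(\Phi,\Theta)$ is an extended equivalence transformation of the class. 3. $(\Phi,\Theta)$ is an extended equivalence transformation of the equations with generic $\theta$ if and only if there are $\delta_1,\dots,\delta_4$ and $X$ as above such that $\Phi$ has the stated form and, for every generic $\theta$, $\Theta\theta$ is given by the formulas with some admissible $\epsilon_1,\dots,\epsilon_4$ (which may depend on $\theta$). 4. If $\Theta$ is separated, then $(\Phi,\Theta)$ is an extended equivalence transformation of the whole class if and only if there are $\delta_1,\dots,\delta_4$, $X$ and $\epsilon_2,\epsilon_3,\epsilon_4$ as above, independent of $\theta$, such that $\Phi$ has the stated form and every $\Theta\theta$ is given by the formulas with some $\epsilon_1\neq0$ (which absorbs the constant of integration and may depend on $\theta$). -/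

import Mathlib

open Set Filter Topology
open scoped ContDiff

namespace Telegraph

/-- The arbitrary elements `(f, g, h, H, K)` of the equations
`f(x) u_tt = (g(x) H(u) u_x)_x + h(x) K(u) u_x`. -/
structure Elements where
  f : ℝ → ℝ
  g : ℝ → ℝ
  h : ℝ → ℝ
  H : ℝ → ℝ
  K : ℝ → ℝ

/-- The class of equations over `x ∈ A`, `u ∈ B`: all arbitrary elements are smooth,
`f`, `g`, `H` have no zeros, and `H`, `K` are not both constant (the equation is nonlinear).
Values outside of `A` and `B` are irrelevant. -/
def classOn (A B : Set ℝ) : Set Elements :=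
  {θ | ContDiffOn ℝ ∞ θ.f A ∧ ContDiffOn ℝ ∞ θ.g A ∧ ContDiffOn ℝ ∞ θ.h A ∧
    ContDiffOn ℝ ∞ θ.H B ∧ ContDiffOn ℝ ∞ θ.K B ∧
    (∀ x ∈ A, θ.f x ≠ 0) ∧ (∀ x ∈ A, θ.g x ≠ 0) ∧ (∀ u ∈ B, θ.H u ≠ 0) ∧
    ∃ u ∈ B, deriv θ.H u ≠ 0 ∨ deriv θ.K u ≠ 0}

/-- The tuples in general position: `h` is not identically zero, and `H`, `K` are linearly
independent. -/
def genericOn (A B : Set ℝ) : Set Elements :=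
  {θ | θ ∈ classOn A B ∧ (∃ x ∈ A, θ.h x ≠ 0) ∧
    ∀ c₁ c₂ : ℝ, (∀ u ∈ B, c₁ * θ.H u + c₂ * θ.K u = 0) → c₁ = 0 ∧ c₂ = 0}

/-- The equation with arbitrary elements `θ` holds for the function `u = u(t, x)` at the point
`p = (t, x)`. -/
def HoldsAt (θ : Elements) (u : ℝ × ℝ → ℝ) (p : ℝ × ℝ) : Prop :=
  θ.f p.2 * iteratedDeriv 2 (fun t => u (t, p.2)) p.1 =
    deriv (fun x => θ.g x * θ.H (u (p.1, x)) * deriv (fun y => u (p.1, y)) x) p.2 +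
      θ.h p.2 * θ.K (u p) * deriv (fun y => u (p.1, y)) p.2

/-- The box `T × I × J` in the space of `(t, x, u)`. -/
def box (T I J : Set ℝ) : Set (ℝ × ℝ × ℝ) := T ×ˢ (I ×ˢ J)

/-- The values of `x̃` on the box. -/
def xImage (T I J : Set ℝ) (Φ : ℝ × ℝ × ℝ → ℝ × ℝ × ℝ) : Set ℝ :=
  (fun p => (Φ p).2.1) '' box T I J

/-- The values of `ũ` on the box. -/
def uImage (T I J : Set ℝ) (Φ : ℝ × ℝ × ℝ → ℝ × ℝ × ℝ) : Set ℝ :=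
  (fun p => (Φ p).2.2) '' box T I J

/-- A nondegenerate point transformation `(t̃, x̃, ũ) = Φ(t, x, u)` on the box: a smooth map with
nonvanishing Jacobian. -/
def IsPointTransformation (T I J : Set ℝ) (Φ : ℝ × ℝ × ℝ → ℝ × ℝ × ℝ) : Prop :=
  ContDiffOn ℝ ∞ Φ (box T I J) ∧ ∀ p ∈ box T I J, (fderiv ℝ Φ p).det ≠ 0

/-- The new independent variables `(t̃, x̃)` as functions of `(t, x)` along the graph of `u`. -/
def newBase (Φ : ℝ × ℝ × ℝ → ℝ × ℝ × ℝ) (u : ℝ × ℝ → ℝ) (q : ℝ × ℝ) : ℝ × ℝ :=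
  ((Φ (q.1, q.2, u q)).1, (Φ (q.1, q.2, u q)).2.1)

/-- `Φ` transforms the equation with arbitrary elements `θ` to the one with `θ'`: the second
prolongation of `Φ` maps the set that the first equation defines in the space of 2-jets to the
set that the second one defines. Jets are given by representatives: `u` is any function of class
`C²` near `p` (it need not satisfy the equation at other points), its graph is transversal in the
new variables at `p`, and `v = v(t̃, x̃)` is the function to which `Φ` takes it. -/
def TransformsEquation (T I J : Set ℝ) (Φ : ℝ × ℝ × ℝ → ℝ × ℝ × ℝ) (θ θ' : Elements) : Prop :=
  ∀ (u v : ℝ × ℝ → ℝ) (p : ℝ × ℝ), p.1 ∈ T → p.2 ∈ I → u p ∈ J →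
    ContDiffAt ℝ 2 u p → (fderiv ℝ (newBase Φ u) p).det ≠ 0 →
    ContDiffAt ℝ 2 v (newBase Φ u p) →
    (∀ᶠ q in 𝓝 p, v (newBase Φ u q) = (Φ (q.1, q.2, u q)).2.2) →
    (HoldsAt θ u p ↔ HoldsAt θ' v (newBase Φ u p))

/-- An extended equivalence transformation of the equations with arbitrary elements in `S`: a
nondegenerate point transformation `Φ` of `(t, x, u)`, the same for all equations, and a rule `Θ`
of any kind (possibly nonlocal) for the new arbitrary elements, such that `Φ` transforms every
equation with arbitrary elements `θ ∈ S` to the equation of the class with arbitrary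
elements `Θ θ`. -/
def IsExtendedEquivalence (T I J : Set ℝ) (S : Set Elements)
    (Φ : ℝ × ℝ × ℝ → ℝ × ℝ × ℝ) (Θ : Elements → Elements) : Prop :=
  IsPointTransformation T I J Φ ∧
    ∀ θ ∈ S, Θ θ ∈ classOn (xImage T I J Φ) (uImage T I J Φ) ∧ TransformsEquation T I J Φ θ (Θ θ)

/-- The rule `Θ` is separated: the new functions `f`, `g`, `h` of `x̃` are determined by the old
functions `f`, `g`, `h` of `x`, and the new functions `H`, `K` of `ũ` by the old functions
`H`, `K` of `u`. -/
def IsSeparated (T I J : Set ℝ) (Φ : ℝ × ℝ × ℝ → ℝ × ℝ × ℝ) (Θ : Elements → Elements) : Prop :=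
  ∀ θ₁ ∈ classOn I J, ∀ θ₂ ∈ classOn I J,
    (EqOn θ₁.f θ₂.f I → EqOn θ₁.g θ₂.g I → EqOn θ₁.h θ₂.h I →
      EqOn (Θ θ₁).f (Θ θ₂).f (xImage T I J Φ) ∧ EqOn (Θ θ₁).g (Θ θ₂).g (xImage T I J Φ) ∧
        EqOn (Θ θ₁).h (Θ θ₂).h (xImage T I J Φ)) ∧
    (EqOn θ₁.H θ₂.H J → EqOn θ₁.K θ₂.K J →
      EqOn (Θ θ₁).H (Θ θ₂).H (uImage T I J Φ) ∧ EqOn (Θ θ₁).K (Θ θ₂).K (uImage T I J Φ))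

/-- The parameters `δ₁, …, δ₄` and `X` of a transformation of the variables. -/
structure VarParams where
  δ₁ : ℝ
  δ₂ : ℝ
  δ₃ : ℝ
  δ₄ : ℝ
  X : ℝ → ℝ

/-- `δ₁ δ₃ ≠ 0`, and `X` is smooth with nonvanishing derivative. -/
def VarParams.Admissible (I : Set ℝ) (d : VarParams) : Prop :=
  d.δ₁ * d.δ₃ ≠ 0 ∧ ContDiffOn ℝ ∞ d.X I ∧ ∀ x ∈ I, deriv d.X x ≠ 0

/-- `t̃ = δ₁ t + δ₂`, `x̃ = X(x)`, `ũ = δ₃ u + δ₄`. -/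
def VarParams.map (d : VarParams) (p : ℝ × ℝ × ℝ) : ℝ × ℝ × ℝ :=
  (d.δ₁ * p.1 + d.δ₂, d.X p.2.1, d.δ₃ * p.2.2 + d.δ₄)

/-- The arbitrary elements `θ'` are obtained from `θ` by the formulas with parameters
`δ₁, …, δ₄, X, ε₁, …, ε₄`, where `P` is an indefinite integral `∫ h/g dx`. -/
def ElementsTransformed (I J : Set ℝ) (d : VarParams) (ε₁ ε₂ ε₃ ε₄ : ℝ) (θ θ' : Elements) :
    Prop :=
  ∃ P : ℝ → ℝ, (∀ x ∈ I, HasDerivAt P (θ.h x / θ.g x) x) ∧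
    (∀ x ∈ I, θ'.f (d.X x) = ε₁ * d.δ₁ ^ 2 / deriv d.X x * θ.f x * Real.exp (-ε₄ * P x)) ∧
    (∀ x ∈ I, θ'.g (d.X x) = ε₁ * ε₂⁻¹ * deriv d.X x * θ.g x * Real.exp (-ε₄ * P x)) ∧
    (∀ x ∈ I, θ'.h (d.X x) = ε₁ * ε₃⁻¹ * θ.h x * Real.exp (-ε₄ * P x)) ∧
    (∀ u ∈ J, θ'.H (d.δ₃ * u + d.δ₄) = ε₂ * θ.H u) ∧
    (∀ u ∈ J, θ'.K (d.δ₃ * u + d.δ₄) = ε₃ * (θ.K u + ε₄ * θ.H u))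

end Telegraph

/-! A quadratic polynomial realizes any prescribed 2-jet at a point. Hence the claim that `Φ` takes
one equation to another is a pointwise statement about free jet variables, and coefficients can be
compared. Since `Φ` is common to all equations, convenient test tuples `θ` may be inserted to
restrict it.

Write `T`, `X`, `U` for the components of `Φ`. The second-order terms (`symbol_relation`) give `f
D_tT D_tX = g H D_xT D_xX` for every value of the gradient of `u`, with `D` the total derivatives.
Two different constants `f` make both products vanish. Since the gradient is free, `T` and `X` do
not depend on `u`, and each depends on only one of `t`, `x` (`independent_of_fiber`). The second
conclusion of `symbol_relation` relates the surviving coefficients. It excludes the interchange of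
`t` and `x`, because `T_x ^ 2` would have to be proportional to every nonvanishing `f`. It also
makes `T` affine and forces the new `H`, taken at `U`, to be `b(x) H(u)`. Testing this with `exp u`
and `exp (u ^ 2)` leaves `U` a function of `u` alone (`exists_variable_form`). Because the equations
contain no `u_t ^ 2`, this function is affine (`exists_varParams`).

With `Φ` known, the remaining coefficients give the formulas for `f`, `g`, `H` up to a common factor
`E(x)`, together with one bilinear identity `E h K - E' g H = h̃ K̃` (`exists_elementsRelated`). If
`h` is not identically zero and `H`, `K` are independent, the identity splits: `K̃` is a combination
of `K` and `H`, and `E' = -ε₄ (h / g) E`. This is the source of the nonlocal exponential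
(`generic_elementsTransformed`). For degenerate tuples it need not split. A separated rule allows
the `x`-part or the `u`-part of a tuple to be combined with the other part of a fixed generic tuple,
which supplies the missing information and makes the constants common
(`separated_elementsTransformed`).

Conversely, under the formulas the new equation, expressed in the old jet, is the old one times a
nonvanishing factor (`ElementsTransformed.transformsEquation`). -/

namespace Telegraph

/-! ### Second derivatives, and functions with a prescribed 2-jet -/

section SecondDerivative

variable {E F G : Type*} [NormedAddCommGroup E] [NormedSpace ℝ E] [NormedAddCommGroup F]
  [NormedSpace ℝ F] [NormedAddCommGroup G] [NormedSpace ℝ G]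

theorem differentiableAt_fderiv {f : E → F} {p : E} (hf : ContDiffAt ℝ 2 f p) :
    DifferentiableAt ℝ (fderiv ℝ f) p :=
  (hf.fderiv_right (m := 1) (by norm_num)).differentiableAt (by norm_num)

theorem eventually_differentiableAt {f : E → F} {p : E} (hf : ContDiffAt ℝ 2 f p) :
    ∀ᶠ q in 𝓝 p, DifferentiableAt ℝ f q := by
  filter_upwards [hf.eventually (by simp)] with q hq
  exact hq.differentiableAt (by norm_num)

/-- The chain rule for second derivatives. -/
theorem fderiv_fderiv_comp {f : F → G} {g : E → F} {p : E} (hf : ContDiffAt ℝ 2 f (g p))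
    (hg : ContDiffAt ℝ 2 g p) (a b : E) :
    fderiv ℝ (fderiv ℝ (fun q => f (g q))) p a b =
      fderiv ℝ (fderiv ℝ f) (g p) (fderiv ℝ g p a) (fderiv ℝ g p b) +
        fderiv ℝ f (g p) (fderiv ℝ (fderiv ℝ g) p a b) := by
  have hgd := hg.differentiableAt (by norm_num)
  have h1 : fderiv ℝ (fun q => f (g q)) =ᶠ[𝓝 p]
      fun q => (fderiv ℝ f (g q)).comp (fderiv ℝ g q) := by
    filter_upwards [eventually_differentiableAt hg,
      hg.continuousAt.eventually (eventually_differentiableAt hf)] with q h1 h2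
    exact fderiv_comp q h2 h1
  have h2 := ((differentiableAt_fderiv hf).hasFDerivAt.comp p hgd.hasFDerivAt).clm_comp
    (differentiableAt_fderiv hg).hasFDerivAt
  rw [h1.fderiv_eq]
  erw [h2.fderiv]
  simp [add_comm]

/-- The quadratic polynomial with value `c`, differential `L` and second differential `B` at
`p`. -/
noncomputable def quadratic (p : E) (c : ℝ) (L : E →L[ℝ] ℝ) (B : E →L[ℝ] E →L[ℝ] ℝ) (q : E) : ℝ :=
  c + L (q - p) + 2⁻¹ * B (q - p) (q - p)

variable (p : E) (c : ℝ) (L : E →L[ℝ] ℝ) (B : E →L[ℝ] E →L[ℝ] ℝ)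

theorem contDiff_quadratic : ContDiff ℝ 2 (quadratic p c L B) := by
  unfold quadratic
  fun_prop

@[simp]
theorem quadratic_self : quadratic p c L B p = c := by simp [quadratic]

theorem fderiv_quadratic (hB : ∀ a b, B a b = B b a) :
    fderiv ℝ (quadratic p c L B) = fun q => L + B (q - p) := by
  ext q a
  have hs : HasFDerivAt (fun q : E => q - p) (ContinuousLinearMap.id ℝ E) q :=
    (hasFDerivAt_id q).sub_const p
  have h1 := ((L.hasFDerivAt.comp q hs).const_add c).add
    (((B.hasFDerivAt.comp q hs).clm_apply hs).const_mul 2⁻¹)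
  have : HasFDerivAt (quadratic p c L B) _ q := h1
  rw [this.fderiv]
  simp [hB a q, hB a p]
  ring

theorem fderiv_quadratic_self (hB : ∀ a b, B a b = B b a) :
    fderiv ℝ (quadratic p c L B) p = L := by
  simp [fderiv_quadratic p c L B hB]

theorem fderiv_fderiv_quadratic (hB : ∀ a b, B a b = B b a) :
    fderiv ℝ (fderiv ℝ (quadratic p c L B)) p = B := by
  rw [fderiv_quadratic p c L B hB]
  exact ((B.hasFDerivAt.comp p ((hasFDerivAt_id p).sub_const p)).const_add L).fderiv

end SecondDerivative

/-! ### Local transforms of functions, and the equation as a condition on 2-jets -/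

theorem det_prod (L : ℝ × ℝ →L[ℝ] ℝ × ℝ) :
    L.det = (L (1, 0)).1 * (L (0, 1)).2 - (L (1, 0)).2 * (L (0, 1)).1 := by
  rw [ContinuousLinearMap.det, ← LinearMap.det_toMatrix (Module.Basis.finTwoProd ℝ),
    Matrix.det_fin_two]
  simp [LinearMap.toMatrix_apply]
  ring

/-- The local existence of the transformed function. -/
theorem exists_comp_eq {E : Type*} [NormedAddCommGroup E] [NormedSpace ℝ E]
    [FiniteDimensional ℝ E] [CompleteSpace E] {τ : E → E} {W : E → ℝ} {p : E}
    (hτ : ContDiffAt ℝ 2 τ p) (hW : ContDiffAt ℝ 2 W p) (hd : (fderiv ℝ τ p).det ≠ 0) :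
    ∃ v : E → ℝ, ContDiffAt ℝ 2 v (τ p) ∧ ∀ᶠ q in 𝓝 p, v (τ q) = W q := by
  set e := (fderiv ℝ τ p).toContinuousLinearEquivOfDetNeZero hd with he
  have h1 : HasFDerivAt τ (e : E →L[ℝ] E) p := by
    have := (hτ.differentiableAt (by norm_num)).hasFDerivAt
    rwa [he, ContinuousLinearMap.coe_toContinuousLinearEquivOfDetNeZero]
  have h2 : ContDiffAt ℝ 2 (hτ.localInverse h1 (by norm_num)) (τ p) :=
    hτ.to_localInverse h1 (by norm_num)
  have h3 : hτ.localInverse h1 (by norm_num) (τ p) = p :=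
    hτ.localInverse_apply_image h1 (by norm_num)
  refine ⟨fun y => W (hτ.localInverse h1 (by norm_num) y), ?_, ?_⟩
  · exact ContDiffAt.comp (τ p) (by rwa [h3]) h2
  · have h4 := (hτ.hasStrictFDerivAt' h1 (by norm_num)).eventually_left_inverse
    filter_upwards [h4] with q hq
    exact congrArg W hq

/-- A line through `p` in the direction `a`: first and second derivatives. -/
theorem deriv_comp_line {E : Type*} [NormedAddCommGroup E] [NormedSpace ℝ E] {u : E → ℝ}
    {ι : ℝ → E} {s₀ : ℝ} {a : E} (hι : ∀ s, HasDerivAt ι a s) (hu : ContDiffAt ℝ 2 u (ι s₀)) :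
    deriv (fun s => u (ι s)) =ᶠ[𝓝 s₀] (fun s => fderiv ℝ u (ι s) a) ∧
      HasDerivAt (deriv fun s => u (ι s)) (fderiv ℝ (fderiv ℝ u) (ι s₀) a a) s₀ := by
  have h1 : deriv (fun s => u (ι s)) =ᶠ[𝓝 s₀] fun s => fderiv ℝ u (ι s) a := by
    filter_upwards [(hι s₀).continuousAt.eventually (eventually_differentiableAt hu)] with s hs
    exact (hs.hasFDerivAt.comp_hasDerivAt s (hι s)).deriv
  refine ⟨h1, HasDerivAt.congr_of_eventuallyEq ?_ h1⟩
  have h2 := ((differentiableAt_fderiv hu).hasFDerivAt.comp_hasDerivAt s₀ (hι s₀)).clm_apply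
    (hasDerivAt_const s₀ a)
  simpa using h2

theorem hasDerivAt_mk_left (x t : ℝ) : HasDerivAt (fun t : ℝ => (t, x)) ((1, 0) : ℝ × ℝ) t :=
  (hasDerivAt_id t).prodMk (hasDerivAt_const t x)

theorem hasDerivAt_mk_right (t x : ℝ) : HasDerivAt (fun x : ℝ => (t, x)) ((0, 1) : ℝ × ℝ) x :=
  (hasDerivAt_const x t).prodMk (hasDerivAt_id x)

/-- The equation as a condition on the 2-jet. -/
theorem holdsAt_iff {θ : Elements} {u : ℝ × ℝ → ℝ} {p : ℝ × ℝ} (hu : ContDiffAt ℝ 2 u p)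
    (hg : DifferentiableAt ℝ θ.g p.2) (hH : DifferentiableAt ℝ θ.H (u p)) :
    HoldsAt θ u p ↔ θ.f p.2 * fderiv ℝ (fderiv ℝ u) p (1, 0) (1, 0) =
      (deriv θ.g p.2 * θ.H (u p) + θ.h p.2 * θ.K (u p)) * fderiv ℝ u p (0, 1) +
        θ.g p.2 * deriv θ.H (u p) * fderiv ℝ u p (0, 1) ^ 2 +
        θ.g p.2 * θ.H (u p) * fderiv ℝ (fderiv ℝ u) p (0, 1) (0, 1) := by
  obtain ⟨t, x⟩ := p
  obtain ⟨-, h1⟩ := deriv_comp_line (s₀ := t) (hasDerivAt_mk_left x) hu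
  obtain ⟨h2, h3⟩ := deriv_comp_line (s₀ := x) (hasDerivAt_mk_right t) hu
  have h4 : HasDerivAt (fun x => u (t, x)) (fderiv ℝ u (t, x) (0, 1)) x :=
    (hu.differentiableAt (by norm_num)).hasFDerivAt.comp_hasDerivAt x (hasDerivAt_mk_right t x)
  have h5 := (hg.hasDerivAt.mul (hH.hasDerivAt.comp x h4)).mul h3
  have h6 : deriv (fun x => θ.g x * θ.H (u (t, x)) * deriv (fun y => u (t, y)) x) x = _ := h5.deriv
  unfold HoldsAt
  rw [iteratedDeriv_succ, iteratedDeriv_one]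
  simp only
  rw [h1.deriv, h6, h4.deriv]
  simp only [Function.comp, Pi.mul_apply]
  constructor <;> intro h <;> linear_combination h

/-- The projection to the independent variables. -/
def baseProj : ℝ × ℝ × ℝ →L[ℝ] ℝ × ℝ :=
  (ContinuousLinearMap.fst ℝ ℝ (ℝ × ℝ)).prod
    ((ContinuousLinearMap.fst ℝ ℝ ℝ).comp (ContinuousLinearMap.snd ℝ ℝ (ℝ × ℝ)))

/-- The projection to the dependent variable. -/
def fiberProj : ℝ × ℝ × ℝ →L[ℝ] ℝ :=
  (ContinuousLinearMap.snd ℝ ℝ ℝ).comp (ContinuousLinearMap.snd ℝ ℝ (ℝ × ℝ))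

/-- The lift of a linear form to its graph. -/
def graphLift (L : ℝ × ℝ →L[ℝ] ℝ) : ℝ × ℝ →L[ℝ] ℝ × ℝ × ℝ :=
  (ContinuousLinearMap.fst ℝ ℝ ℝ).prod ((ContinuousLinearMap.snd ℝ ℝ ℝ).prod L)

@[simp]
theorem baseProj_apply (y : ℝ × ℝ × ℝ) : baseProj y = (y.1, y.2.1) := rfl

@[simp]
theorem fiberProj_apply (y : ℝ × ℝ × ℝ) : fiberProj y = y.2.2 := rfl

@[simp]
theorem graphLift_apply (L : ℝ × ℝ →L[ℝ] ℝ) (a : ℝ × ℝ) : graphLift L a = (a.1, a.2, L a) := rfl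

/-! ### Prolongation of a point transformation to 2-jets -/

section Jets

variable {Φ : ℝ × ℝ × ℝ → ℝ × ℝ × ℝ} {u v : ℝ × ℝ → ℝ} {p : ℝ × ℝ}

theorem contDiffAt_graph (hu : ContDiffAt ℝ 2 u p) :
    ContDiffAt ℝ 2 (fun q : ℝ × ℝ => (q.1, q.2, u q)) p :=
  contDiffAt_fst.prodMk (contDiffAt_snd.prodMk hu)

theorem fderiv_graph {q : ℝ × ℝ} (hu : DifferentiableAt ℝ u q) :
    fderiv ℝ (fun q : ℝ × ℝ => (q.1, q.2, u q)) q = graphLift (fderiv ℝ u q) :=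
  (hasFDerivAt_fst.prodMk (hasFDerivAt_snd.prodMk hu.hasFDerivAt)).fderiv

theorem fderiv_fderiv_graph (hu : ContDiffAt ℝ 2 u p) (a b : ℝ × ℝ) :
    fderiv ℝ (fderiv ℝ (fun q : ℝ × ℝ => (q.1, q.2, u q))) p a b =
      (0, 0, fderiv ℝ (fderiv ℝ u) p a b) := by
  set k : ℝ →L[ℝ] ℝ × ℝ × ℝ := (ContinuousLinearMap.inr ℝ ℝ (ℝ × ℝ)).comp
    (ContinuousLinearMap.inr ℝ ℝ ℝ) with hk
  have h1 : fderiv ℝ (fun q : ℝ × ℝ => (q.1, q.2, u q)) =ᶠ[𝓝 p]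
      fun q => graphLift 0 + k.comp (fderiv ℝ u q) := by
    filter_upwards [eventually_differentiableAt hu] with q hq
    rw [fderiv_graph hq]
    ext <;> simp [hk]
  have h2 := ((hasFDerivAt_const k p).clm_comp
    (differentiableAt_fderiv hu).hasFDerivAt).const_add (graphLift 0)
  rw [h1.fderiv_eq, h2.fderiv]
  simp [hk]

theorem contDiffAt_newBase (hΦ : ContDiffAt ℝ 2 Φ (p.1, p.2, u p)) (hu : ContDiffAt ℝ 2 u p) :
    ContDiffAt ℝ 2 (newBase Φ u) p :=
  baseProj.contDiff.contDiffAt.comp p (ContDiffAt.comp p hΦ (contDiffAt_graph hu))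

theorem fderiv_newBase (hΦ : ContDiffAt ℝ 2 Φ (p.1, p.2, u p)) (hu : ContDiffAt ℝ 2 u p) :
    fderiv ℝ (newBase Φ u) p =
      baseProj.comp ((fderiv ℝ Φ (p.1, p.2, u p)).comp (graphLift (fderiv ℝ u p))) := by
  have h1 := hu.differentiableAt (by norm_num)
  have h2 := (contDiffAt_graph hu).differentiableAt (by norm_num)
  have h3 := (hΦ.differentiableAt (by norm_num)).hasFDerivAt.comp p h2.hasFDerivAt
  have h4 := baseProj.hasFDerivAt.comp p h3
  rw [fderiv_graph h1] at h4
  exact h4.fderiv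

theorem fderiv_fderiv_clm {E F : Type*} [NormedAddCommGroup E] [NormedSpace ℝ E]
    [NormedAddCommGroup F] [NormedSpace ℝ F] (L : E →L[ℝ] F) (p : E) :
    fderiv ℝ (fderiv ℝ L) p = 0 := by
  have : fderiv ℝ L = fun _ => L := funext fun q => L.fderiv
  rw [this, fderiv_const_apply]

/-- The transformation of 2-jets. -/
theorem jet_relation (hΦ : ContDiffAt ℝ 2 Φ (p.1, p.2, u p)) (hu : ContDiffAt ℝ 2 u p)
    (hv : ContDiffAt ℝ 2 v (newBase Φ u p))
    (h : ∀ᶠ q in 𝓝 p, v (newBase Φ u q) = (Φ (q.1, q.2, u q)).2.2) :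
    (∀ a, fderiv ℝ v (newBase Φ u p) (fderiv ℝ (newBase Φ u) p a) =
      fiberProj (fderiv ℝ Φ (p.1, p.2, u p) (graphLift (fderiv ℝ u p) a))) ∧
    ∀ a b, fderiv ℝ (fderiv ℝ v) (newBase Φ u p) (fderiv ℝ (newBase Φ u) p a)
        (fderiv ℝ (newBase Φ u) p b) =
      (fiberProj - (fderiv ℝ v (newBase Φ u p)).comp baseProj)
        (fderiv ℝ (fderiv ℝ Φ) (p.1, p.2, u p) (graphLift (fderiv ℝ u p) a)
          (graphLift (fderiv ℝ u p) b) +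
        fderiv ℝ Φ (p.1, p.2, u p) (0, 0, fderiv ℝ (fderiv ℝ u) p a b)) := by
  have hγ := contDiffAt_graph hu
  have hu1 := hu.differentiableAt (by norm_num)
  have hΨ : ContDiffAt ℝ 2 (fun q : ℝ × ℝ => Φ (q.1, q.2, u q)) p := ContDiffAt.comp p hΦ hγ
  have hΨ1 := hΨ.differentiableAt (by norm_num)
  have hτ := contDiffAt_newBase hΦ hu
  have e : (fun q => v (newBase Φ u q)) =ᶠ[𝓝 p] fun q => fiberProj (Φ (q.1, q.2, u q)) := h
  constructor
  · intro a
    have h1 := (hv.differentiableAt (by norm_num)).hasFDerivAt.comp p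
      (hτ.differentiableAt (by norm_num)).hasFDerivAt
    have h2 := fiberProj.hasFDerivAt.comp p ((hΦ.differentiableAt (by norm_num)).hasFDerivAt.comp p
      (hγ.differentiableAt (by norm_num)).hasFDerivAt)
    rw [fderiv_graph hu1] at h2
    have := h1.unique (h2.congr_of_eventuallyEq e)
    exact congrArg (fun L : ℝ × ℝ →L[ℝ] ℝ => L a) this
  · intro a b
    have h1 := fderiv_fderiv_comp hv hτ a b
    have h2 := fderiv_fderiv_comp (f := fiberProj) fiberProj.contDiff.contDiffAt hΨ a b
    have h3 := fderiv_fderiv_comp (f := baseProj) baseProj.contDiff.contDiffAt hΨ a b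
    have h4 := fderiv_fderiv_comp (g := fun q : ℝ × ℝ => (q.1, q.2, u q)) hΦ hγ a b
    rw [fderiv_graph hu1, fderiv_fderiv_graph hu] at h4
    rw [fderiv_fderiv_clm, ContinuousLinearMap.fderiv] at h2 h3
    have h5 : fderiv ℝ (fderiv ℝ (newBase Φ u)) p a b =
        baseProj (fderiv ℝ (fderiv ℝ (fun q : ℝ × ℝ => Φ (q.1, q.2, u q))) p a b) :=
      h3.trans (zero_add _)
    rw [e.fderiv.fderiv_eq, h2, h5, h4] at h1
    simp only [_root_.zero_apply, zero_add] at h1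
    rw [_root_.sub_apply, ContinuousLinearMap.comp_apply]
    linarith

theorem clm_injective_of_det_ne_zero {E : Type*} [NormedAddCommGroup E] [NormedSpace ℝ E]
    [FiniteDimensional ℝ E] {L : E →L[ℝ] E} (h : L.det ≠ 0) : Function.Bijective L := by
  have := (L.toContinuousLinearEquivOfDetNeZero h).bijective
  rwa [← ContinuousLinearMap.coe_toContinuousLinearEquivOfDetNeZero L h]

end Jets

/-! ### Comparison of the principal parts -/

/-- An affine function vanishing on a plane is a multiple of the equation of that plane. Three
points of the plane suffice to compare the linear parts. In the application the `sᵢ` are the second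
derivatives of the transformed function. -/
theorem symbol_of_affine {c₁ c₂ c₃ c₄ F G L : ℝ} (hF : F ≠ 0)
    (h : ∀ s₁ s₂ s₃ : ℝ, F * s₁ - G * s₃ = L → c₁ * s₁ + c₂ * s₂ + c₃ * s₃ = c₄) :
    c₂ = 0 ∧ c₁ * G + c₃ * F = 0 := by
  have h1 := h (L / F) 0 0 (by field_simp; ring)
  have h2 := h (L / F) 1 0 (by field_simp; ring)
  have h3 := h ((L + G) / F) 0 1 (by field_simp; ring)
  refine ⟨by linarith, ?_⟩
  field_simp at h1 h3
  linarith

theorem two_le_infty : (2 : WithTop ℕ∞) ≤ ∞ := WithTop.coe_le_coe.2 le_top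

theorem isOpen_box {T I J : Set ℝ} (hT : IsOpen T) (hI : IsOpen I) (hJ : IsOpen J) :
    IsOpen (box T I J) := hT.prod (hI.prod hJ)

section

variable {T I J : Set ℝ} {Φ : ℝ × ℝ × ℝ → ℝ × ℝ × ℝ} {z : ℝ × ℝ × ℝ}

theorem IsPointTransformation.contDiffAt (hB : IsOpen (box T I J))
    (hΦ : IsPointTransformation T I J Φ) (hz : z ∈ box T I J) : ContDiffAt ℝ ∞ Φ z :=
  hΦ.1.contDiffAt (hB.mem_nhds hz)

/-- The inverse function theorem at each point. It makes the ranges of `x̃` and `ũ` neighbourhoods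
of their points, so that smoothness of the new arbitrary elements on these ranges yields genuine
differentiability there. -/
theorem IsPointTransformation.image_mem_nhds (hB : IsOpen (box T I J))
    (hΦ : IsPointTransformation T I J Φ) (hz : z ∈ box T I J) : Φ '' box T I J ∈ 𝓝 (Φ z) := by
  have h1 := (hΦ.contDiffAt hB hz).hasStrictFDerivAt (by simp)
  rw [← h1.map_nhds_eq_of_surj
    (LinearMap.range_eq_top.2 (clm_injective_of_det_ne_zero (hΦ.2 z hz)).2)]
  exact image_mem_map (hB.mem_nhds hz)

theorem IsPointTransformation.xImage_mem_nhds (hB : IsOpen (box T I J))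
    (hΦ : IsPointTransformation T I J Φ) (hz : z ∈ box T I J) :
    xImage T I J Φ ∈ 𝓝 (Φ z).2.1 := by
  have h : (fun y : ℝ × ℝ × ℝ => y.2.1) '' (Φ '' box T I J) ∈ 𝓝 (Φ z).2.1 :=
    (isOpenMap_fst.comp isOpenMap_snd).image_mem_nhds (hΦ.image_mem_nhds hB hz)
  rwa [image_image] at h

theorem IsPointTransformation.uImage_mem_nhds (hB : IsOpen (box T I J))
    (hΦ : IsPointTransformation T I J Φ) (hz : z ∈ box T I J) :
    uImage T I J Φ ∈ 𝓝 (Φ z).2.2 := by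
  have h : (fun y : ℝ × ℝ × ℝ => y.2.2) '' (Φ '' box T I J) ∈ 𝓝 (Φ z).2.2 :=
    (isOpenMap_snd.comp isOpenMap_snd).image_mem_nhds (hΦ.image_mem_nhds hB hz)
  rwa [image_image] at h

/-- The transformation of the coefficients of the second derivatives. -/
theorem symbol_relation (hB : IsOpen (box T I J)) (hI : IsOpen I) (hJ : IsOpen J)
    (hΦ : IsPointTransformation T I J Φ) {θ θ' : Elements} (hθ : θ ∈ classOn I J)
    (hθ' : θ' ∈ classOn (xImage T I J Φ) (uImage T I J Φ))
    (h : TransformsEquation T I J Φ θ θ') (hz : z ∈ box T I J) {a b : ℝ} {α β : ℝ × ℝ × ℝ}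
    (hα : fderiv ℝ Φ z (1, 0, a) = α) (hβ : fderiv ℝ Φ z (0, 1, b) = β)
    (hd : α.1 * β.2.1 - α.2.1 * β.1 ≠ 0) :
    θ.f z.2.1 * (α.1 * α.2.1) = θ.g z.2.1 * θ.H z.2.2 * (β.1 * β.2.1) ∧
      (θ.f z.2.1 * α.1 ^ 2 - θ.g z.2.1 * θ.H z.2.2 * β.1 ^ 2) *
          (θ'.g (Φ z).2.1 * θ'.H (Φ z).2.2) +
        (θ.f z.2.1 * α.2.1 ^ 2 - θ.g z.2.1 * θ.H z.2.2 * β.2.1 ^ 2) * θ'.f (Φ z).2.1 = 0 := by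
  obtain ⟨t, x, w⟩ := z
  have hΦz : ContDiffAt ℝ 2 Φ (t, x, w) := (hΦ.contDiffAt hB hz).of_le two_le_infty
  have hzI : x ∈ I := hz.2.1
  have hzJ : w ∈ J := hz.2.2
  -- `L` is the gradient of `u`, `A` the resulting differential of the new base variables, and `m`
  -- the gradient that the transformed function must then have.
  set L : ℝ × ℝ →L[ℝ] ℝ := a • ContinuousLinearMap.fst ℝ ℝ ℝ + b • ContinuousLinearMap.snd ℝ ℝ ℝ
    with hL
  set A : ℝ × ℝ →L[ℝ] ℝ × ℝ :=
    baseProj.comp ((fderiv ℝ Φ (t, x, w)).comp (graphLift L)) with hA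
  have hA1 : A (1, 0) = (α.1, α.2.1) := by simp [hA, hL, hα]
  have hA2 : A (0, 1) = (β.1, β.2.1) := by simp [hA, hL, hβ]
  have hAdet : A.det ≠ 0 := by rw [det_prod, hA1, hA2]; exact hd
  have hAb := clm_injective_of_det_ne_zero hAdet
  set m : ℝ × ℝ →L[ℝ] ℝ := (fiberProj.comp ((fderiv ℝ Φ (t, x, w)).comp (graphLift L))).comp
    ((A.toContinuousLinearEquivOfDetNeZero hAdet).symm : ℝ × ℝ →L[ℝ] ℝ × ℝ) with hm
  have hmA : ∀ c, m (A c) = fiberProj (fderiv ℝ Φ (t, x, w) (graphLift L c)) := by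
    intro c
    have : (A.toContinuousLinearEquivOfDetNeZero hAdet).symm (A c) = c :=
      (A.toContinuousLinearEquivOfDetNeZero hAdet).symm_apply_apply c
    simp only [hm, ContinuousLinearMap.comp_apply, ContinuousLinearEquiv.coe_coe, this]
  -- The form `ℓ` annihilates the tangent plane of the transformed graph. Its value `j` on the image
  -- of the vertical direction is the factor with which second derivatives of `u` enter those of the
  -- transformed function.
  set ℓ : ℝ × ℝ × ℝ →L[ℝ] ℝ := fiberProj - m.comp baseProj with hℓ
  have hℓ0 : ∀ c, ℓ (fderiv ℝ Φ (t, x, w) (graphLift L c)) = 0 := by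
    intro c
    rw [hℓ, _root_.sub_apply, ← hmA]
    exact sub_self _
  set j : ℝ := ℓ (fderiv ℝ Φ (t, x, w) (0, 0, 1)) with hj
  have hjmul : ∀ r : ℝ, ℓ (fderiv ℝ Φ (t, x, w) (0, 0, r)) = r * j := by
    intro r
    have : ((0, 0, r) : ℝ × ℝ × ℝ) = r • (0, 0, 1) := by simp
    rw [this, map_smul, map_smul, smul_eq_mul]
  have hj0 : j ≠ 0 := by
    intro h0
    -- If `j` were zero, `ℓ` would vanish on the tangent plane and on the vertical direction, hence
    -- on the whole range of the surjective differential of `Φ`.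
    obtain ⟨y, hy⟩ := (clm_injective_of_det_ne_zero (hΦ.2 _ hz)).2 (0, 0, 1)
    have h1 : y = graphLift L (y.1, y.2.1) + (0, 0, y.2.2 - L (y.1, y.2.1)) := by
      ext <;> simp
    have h2 : ℓ (0, 0, 1) = 1 := by simp [hℓ, Prod.mk_zero_zero]
    rw [← hy, h1, map_add, map_add, hℓ0, hjmul, h0] at h2
    simp at h2
  set C : ℝ × ℝ →L[ℝ] ℝ × ℝ →L[ℝ] ℝ := (ContinuousLinearMap.compL ℝ (ℝ × ℝ) _ ℝ ℓ).comp
    ((fderiv ℝ (fderiv ℝ Φ) (t, x, w)).bilinearComp (graphLift L) (graphLift L)) with hC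
  have hCapp : ∀ c d, C c d =
      ℓ (fderiv ℝ (fderiv ℝ Φ) (t, x, w) (graphLift L c) (graphLift L d)) := fun c d => rfl
  have hCsymm : ∀ c d, C c d = C d c := by
    intro c d
    rw [hCapp, hCapp, (hΦz.isSymmSndFDerivAt (by simp)).eq]
  have hxm : DifferentiableAt ℝ θ'.g (Φ (t, x, w)).2.1 :=
    (hθ'.2.1.contDiffAt (hΦ.xImage_mem_nhds hB hz)).differentiableAt (by simp)
  have hum : DifferentiableAt ℝ θ'.H (Φ (t, x, w)).2.2 :=
    (hθ'.2.2.2.1.contDiffAt (hΦ.uImage_mem_nhds hB hz)).differentiableAt (by simp)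
  have hF : θ'.f (Φ (t, x, w)).2.1 ≠ 0 :=
    hθ'.2.2.2.2.2.1 _ (mem_of_mem_nhds (hΦ.xImage_mem_nhds hB hz))
  have key : ∀ s₁ s₂ s₃ : ℝ, θ'.f (Φ (t, x, w)).2.1 * s₁ -
        θ'.g (Φ (t, x, w)).2.1 * θ'.H (Φ (t, x, w)).2.2 * s₃ =
        (deriv θ'.g (Φ (t, x, w)).2.1 * θ'.H (Φ (t, x, w)).2.2 +
          θ'.h (Φ (t, x, w)).2.1 * θ'.K (Φ (t, x, w)).2.2) * m (0, 1) +
        θ'.g (Φ (t, x, w)).2.1 * deriv θ'.H (Φ (t, x, w)).2.2 * m (0, 1) ^ 2 →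
      (θ.f x * α.1 ^ 2 - θ.g x * θ.H w * β.1 ^ 2) * s₁ +
          2 * (θ.f x * (α.1 * α.2.1) - θ.g x * θ.H w * (β.1 * β.2.1)) * s₂ +
          (θ.f x * α.2.1 ^ 2 - θ.g x * θ.H w * β.2.1 ^ 2) * s₃ =
        ((deriv θ.g x * θ.H w + θ.h x * θ.K w) * L (0, 1) +
          θ.g x * deriv θ.H w * L (0, 1) ^ 2) * j +
        θ.f x * C (1, 0) (1, 0) - θ.g x * θ.H w * C (0, 1) (0, 1) := by
    intro s₁ s₂ s₃ hs
    set S : ℝ × ℝ →L[ℝ] ℝ × ℝ →L[ℝ] ℝ :=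
      (ContinuousLinearMap.fst ℝ ℝ ℝ).smulRight
        (s₁ • ContinuousLinearMap.fst ℝ ℝ ℝ + s₂ • ContinuousLinearMap.snd ℝ ℝ ℝ) +
      (ContinuousLinearMap.snd ℝ ℝ ℝ).smulRight
        (s₂ • ContinuousLinearMap.fst ℝ ℝ ℝ + s₃ • ContinuousLinearMap.snd ℝ ℝ ℝ) with hS
    have hSapp : ∀ c d : ℝ × ℝ, S c d = s₁ * (c.1 * d.1) + s₂ * (c.1 * d.2 + c.2 * d.1) +
        s₃ * (c.2 * d.2) := by
      intro c d
      simp [hS]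
      ring
    -- The second-order relation between the jets is solved for the Hessian of `u`, so that the
    -- transformed function has the arbitrarily prescribed Hessian `S`.
    set B : ℝ × ℝ →L[ℝ] ℝ × ℝ →L[ℝ] ℝ := j⁻¹ • (S.bilinearComp A A - C) with hBdef
    have hBapp : ∀ c d, B c d = j⁻¹ * (S (A c) (A d) - C c d) := fun c d => rfl
    have hBsymm : ∀ c d, B c d = B d c := by
      intro c d
      rw [hBapp, hBapp, hCsymm c d, hSapp, hSapp]
      ring
    set u := quadratic (t, x) w L B with hu_def
    have hu0 : u (t, x) = w := quadratic_self _ _ _ _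
    have hu1 : fderiv ℝ u (t, x) = L := fderiv_quadratic_self _ _ _ _ hBsymm
    have hu2 : fderiv ℝ (fderiv ℝ u) (t, x) = B := fderiv_fderiv_quadratic _ _ _ _ hBsymm
    have hu : ContDiffAt ℝ 2 u (t, x) := (contDiff_quadratic _ _ _ _).contDiffAt
    have hΦu : ContDiffAt ℝ 2 Φ ((t, x).1, (t, x).2, u (t, x)) := by rw [hu0]; exact hΦz
    have hτ := contDiffAt_newBase hΦu hu
    have hτ1 : fderiv ℝ (newBase Φ u) (t, x) = A := by
      rw [fderiv_newBase hΦu hu, hu1, hu0]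
    have hW : ContDiffAt ℝ 2 (fun q : ℝ × ℝ => (Φ (q.1, q.2, u q)).2.2) (t, x) :=
      fiberProj.contDiff.contDiffAt.comp (t, x) (ContDiffAt.comp (t, x) hΦu (contDiffAt_graph hu))
    obtain ⟨v, hv, hvτ⟩ := exists_comp_eq hτ hW (by rw [hτ1]; exact hAdet)
    obtain ⟨hj1, hj2⟩ := jet_relation hΦu hu hv hvτ
    have hb0 : newBase Φ u (t, x) = ((Φ (t, x, w)).1, (Φ (t, x, w)).2.1) := by
      simp only [newBase, hu0]
    have hv0 : v (newBase Φ u (t, x)) = (Φ (t, x, w)).2.2 := by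
      rw [hvτ.self_of_nhds]
      simp only [hu0]
    simp only [hτ1, hu1, hu0] at hj1
    simp only [hτ1, hu1, hu0, hu2] at hj2
    have hvm : fderiv ℝ v (newBase Φ u (t, x)) = m := by
      refine ContinuousLinearMap.ext fun y => ?_
      obtain ⟨c, rfl⟩ := hAb.2 y
      rw [hj1, hmA]
    have hvS : fderiv ℝ (fderiv ℝ v) (newBase Φ u (t, x)) = S := by
      refine ContinuousLinearMap.ext fun y => ContinuousLinearMap.ext fun y' => ?_
      obtain ⟨c, rfl⟩ := hAb.2 y
      obtain ⟨c', rfl⟩ := hAb.2 y'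
      rw [hj2, hvm, ← hℓ, map_add, hjmul, ← hCapp, hBapp]
      field_simp
      ring
    have hiff := h u v (t, x) hz.1 hzI (by rw [hu0]; exact hzJ) hu (by rw [hτ1]; exact hAdet) hv hvτ
    have hgd : DifferentiableAt ℝ θ.g x :=
      (hθ.2.1.contDiffAt (hI.mem_nhds hzI)).differentiableAt (by simp)
    have hHd : DifferentiableAt ℝ θ.H w :=
      (hθ.2.2.2.1.contDiffAt (hJ.mem_nhds hzJ)).differentiableAt (by simp)
    rw [holdsAt_iff hu hgd (by rw [hu0]; exact hHd),
      holdsAt_iff hv (by rw [hb0]; exact hxm) (by rw [hv0]; exact hum), hvS, hvm, hu1, hu2,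
      hv0, hu0, hb0, hBapp, hBapp, hSapp, hSapp, hSapp, hSapp, hA1, hA2] at hiff
    -- Only the implication from the new equation to the old one is used: every jet on the new
    -- equation comes from a jet on the old one.
    have := hiff.2 (by simp only; linear_combination hs)
    simp only at this
    field_simp at this
    linear_combination this
  obtain ⟨h1, h2⟩ := symbol_of_affine hF key
  exact ⟨by linarith, h2⟩

end

/-- By continuity both affine functions stay nonzero near `e = 0`, and a punctured neighbourhood is
nonempty. This allows one component of the gradient to be perturbed without leaving the
nondegenerate situation. -/
theorem exists_ne_zero_of_affine {c₁ c₂ : ℝ} (d₁ d₂ : ℝ) (h₁ : c₁ ≠ 0) (h₂ : c₂ ≠ 0) :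
    ∃ e : ℝ, e ≠ 0 ∧ c₁ + e * d₁ ≠ 0 ∧ c₂ + e * d₂ ≠ 0 := by
  have h : ∀ {c : ℝ} (d : ℝ), c ≠ 0 → ∀ᶠ e in 𝓝[≠] (0 : ℝ), c + e * d ≠ 0 := by
    intro c d hc
    have : ContinuousAt (fun e : ℝ => c + e * d) 0 := by fun_prop
    exact (this.eventually_ne (by simpa using hc)).filter_mono nhdsWithin_le_nhds
  have h3 : ∀ᶠ e in 𝓝[≠] (0 : ℝ), e ≠ 0 := eventually_mem_nhdsWithin
  obtain ⟨e, he1, he2, he3⟩ := (h3.and ((h d₁ h₁).and (h d₂ h₂))).exists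
  exact ⟨e, he1, he2, he3⟩

/-- The algebraic consequence of the vanishing of the mixed coefficient. -/
theorem independent_of_fiber {Tt Tx Tu Xt Xx Xu : ℝ}
    (hne : ¬(Tt * Xx - Xt * Tx = 0 ∧ Tu * Xx - Xu * Tx = 0 ∧ Tt * Xu - Xt * Tu = 0))
    (h : ∀ a b : ℝ, (Tt + a * Tu) * (Xx + b * Xu) - (Xt + a * Xu) * (Tx + b * Tu) ≠ 0 →
      (Tt + a * Tu) * (Xt + a * Xu) = 0 ∧ (Tx + b * Tu) * (Xx + b * Xu) = 0) :
    Tu = 0 ∧ Xu = 0 ∧ ((Tt = 0 ∧ Xx = 0) ∨ (Xt = 0 ∧ Tx = 0)) := by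
  -- If the determinant vanished at `(0, 0)`, `(1, 0)` and `(0, 1)`, all three minors excluded by
  -- `hne` would vanish.
  obtain ⟨a, b, hab⟩ : ∃ a b : ℝ,
      (Tt + a * Tu) * (Xx + b * Xu) - (Xt + a * Xu) * (Tx + b * Tu) ≠ 0 := by
    by_contra! hc
    have h1 := hc 0 0
    have h2 := hc 1 0
    have h3 := hc 0 1
    exact hne ⟨by linarith, by linarith, by linarith⟩
  obtain ⟨h1, h2⟩ := h a b hab
  -- An invertible 2 × 2 matrix with a zero in each row is diagonal or antidiagonal.
  have hperm : ∀ {α₁ α₂ β₁ β₂ : ℝ} (_ : α₁ * β₂ - α₂ * β₁ ≠ 0) (_ : α₁ * α₂ = 0)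
      (_ : β₁ * β₂ = 0), (α₁ = 0 ∧ β₂ = 0 ∧ α₂ ≠ 0 ∧ β₁ ≠ 0) ∨
        (α₂ = 0 ∧ β₁ = 0 ∧ α₁ ≠ 0 ∧ β₂ ≠ 0) := by
    intro α₁ α₂ β₁ β₂ hd hα hβ
    rcases mul_eq_zero.1 hα with h0 | h0 <;> rcases mul_eq_zero.1 hβ with h0' | h0' <;>
      simp_all
  have hu : Tu = 0 ∧ Xu = 0 := by
    -- After a small shift of `a` or `b`, the nonzero entry of the row is still nonzero, so the zero
    -- entry must remain zero. The shift changes it by a nonzero multiple of `Tu` or `Xu`, which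
    -- therefore vanishes.
    rcases hperm hab h1 h2 with ⟨e1, e2, n1, n2⟩ | ⟨e1, e2, n1, n2⟩
    · obtain ⟨e, he, he1, he2⟩ := exists_ne_zero_of_affine Xu
        (Tu * (Xx + b * Xu) - Xu * (Tx + b * Tu)) n1 hab
      obtain ⟨f, hf, hf1, hf2⟩ := exists_ne_zero_of_affine Tu
        ((Tt + a * Tu) * Xu - (Xt + a * Xu) * Tu) n2 hab
      have h3 := (h (a + e) b (by convert he2 using 1; ring)).1
      have h4 := (h a (b + f) (by convert hf2 using 1; ring)).2
      have h5 : Tt + (a + e) * Tu = 0 := (mul_eq_zero.1 h3).resolve_right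
        (fun h => he1 (by linarith))
      have h6 : Xx + (b + f) * Xu = 0 := (mul_eq_zero.1 h4).resolve_left
        (fun h => hf1 (by linarith))
      exact ⟨(mul_eq_zero.1 (show e * Tu = 0 by linarith)).resolve_left he,
        (mul_eq_zero.1 (show f * Xu = 0 by linarith)).resolve_left hf⟩
    · obtain ⟨e, he, he1, he2⟩ := exists_ne_zero_of_affine Tu
        (Tu * (Xx + b * Xu) - Xu * (Tx + b * Tu)) n1 hab
      obtain ⟨f, hf, hf1, hf2⟩ := exists_ne_zero_of_affine Xu
        ((Tt + a * Tu) * Xu - (Xt + a * Xu) * Tu) n2 hab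
      have h3 := (h (a + e) b (by convert he2 using 1; ring)).1
      have h4 := (h a (b + f) (by convert hf2 using 1; ring)).2
      have h5 : Xt + (a + e) * Xu = 0 := (mul_eq_zero.1 h3).resolve_left
        (fun h => he1 (by linarith))
      have h6 : Tx + (b + f) * Tu = 0 := (mul_eq_zero.1 h4).resolve_right
        (fun h => hf1 (by linarith))
      exact ⟨(mul_eq_zero.1 (show f * Tu = 0 by linarith)).resolve_left hf,
        (mul_eq_zero.1 (show e * Xu = 0 by linarith)).resolve_left he⟩
  obtain ⟨rfl, rfl⟩ := hu
  simp only [mul_zero, add_zero] at hab h1 h2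
  rcases hperm hab h1 h2 with ⟨e1, e2, -, -⟩ | ⟨e1, e2, -, -⟩
  · exact ⟨rfl, rfl, Or.inl ⟨e1, e2⟩⟩
  · exact ⟨rfl, rfl, Or.inr ⟨e1, e2⟩⟩

/-! ### Generic test equations -/

section Generic

variable {I J : Set ℝ}

/-- A nonconstant `H` and the constant `1` are independent: differentiating a linear relation at
`u₀` isolates the coefficient of `H`. These tests probe the dependence of `ũ` on the variables. -/
theorem generic_of_deriv (hJ : IsOpen J) (hI' : I.Nonempty) {F H : ℝ → ℝ} (hF : ContDiff ℝ ∞ F)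
    (hF0 : ∀ x, F x ≠ 0) (hH : ContDiff ℝ ∞ H) (hH0 : ∀ u, H u ≠ 0) {u₀ : ℝ} (hu₀ : u₀ ∈ J)
    (hd : deriv H u₀ ≠ 0) :
    (⟨F, fun _ => 1, fun _ => 1, H, fun _ => 1⟩ : Elements) ∈ genericOn I J := by
  refine ⟨⟨hF.contDiffOn, contDiffOn_const, contDiffOn_const, hH.contDiffOn, contDiffOn_const,
    fun x _ => hF0 x, fun _ _ => one_ne_zero, fun u _ => hH0 u, u₀, hu₀, Or.inl hd⟩,
    ⟨hI'.some, hI'.some_mem, one_ne_zero⟩, fun c₁ c₂ h => ?_⟩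
  have h1 : (fun u => c₁ * H u + c₂ * 1) =ᶠ[𝓝 u₀] fun _ => 0 := by
    filter_upwards [hJ.mem_nhds hu₀] with u hu using h u hu
  have h2 := h1.deriv_eq
  rw [deriv_add_const, deriv_const_mul _ (hH.differentiable (by simp) u₀), deriv_const] at h2
  have h3 := (mul_eq_zero.1 h2).resolve_right hd
  have h4 := h u₀ hu₀
  simp only [h3, zero_mul, zero_add, mul_one] at h4
  exact ⟨h3, h4⟩

/-- With `H = 1` the principal part does not involve `u`, while `K = u` keeps the tuple generic.
These tests probe the new independent variables. -/
theorem generic_id (hJ : IsOpen J) (hJ' : J.Nonempty) {F g h : ℝ → ℝ} (hF : ContDiffOn ℝ ∞ F I)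
    (hF0 : ∀ x ∈ I, F x ≠ 0) (hg : ContDiffOn ℝ ∞ g I) (hg0 : ∀ x ∈ I, g x ≠ 0)
    (hh : ContDiffOn ℝ ∞ h I) (hh0 : ∃ x ∈ I, h x ≠ 0) :
    (⟨F, g, h, fun _ => 1, fun u => u⟩ : Elements) ∈ genericOn I J := by
  obtain ⟨u₀, hu₀⟩ := hJ'
  refine ⟨⟨hF, hg, hh, contDiffOn_const, contDiffOn_id, hF0, hg0, fun _ _ => one_ne_zero, u₀, hu₀,
    Or.inr ?_⟩, hh0, fun c₁ c₂ h => ?_⟩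
  · rw [deriv_id'']; exact one_ne_zero
  have h1 : (fun u => c₁ * 1 + c₂ * u) =ᶠ[𝓝 u₀] fun _ => 0 := by
    filter_upwards [hJ.mem_nhds hu₀] with u hu using h u hu
  have h2 := h1.deriv_eq
  rw [deriv_const_add, deriv_const_mul _ differentiableAt_id, deriv_const, deriv_id'', mul_one] at h2
  have h4 := h u₀ hu₀
  simp only [h2, zero_mul, add_zero, mul_one] at h4
  exact ⟨h4, h2⟩

theorem generic_id_of_contDiff (hJ : IsOpen J) (hI' : I.Nonempty) (hJ' : J.Nonempty) {F : ℝ → ℝ}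
    (hF : ContDiff ℝ ∞ F) (hF0 : ∀ x, F x ≠ 0) :
    (⟨F, fun _ => 1, fun _ => 1, fun _ => 1, fun u => u⟩ : Elements) ∈ genericOn I J :=
  generic_id hJ hJ' hF.contDiffOn (fun x _ => hF0 x) contDiffOn_const (fun _ _ => one_ne_zero)
    contDiffOn_const ⟨hI'.some, hI'.some_mem, one_ne_zero⟩

end Generic

/-! ### Dependence of the new independent variables on the old ones -/

section

variable {T I J : Set ℝ} {Φ : ℝ × ℝ × ℝ → ℝ × ℝ × ℝ} {Θ : Elements → Elements} {z : ℝ × ℝ × ℝ}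

theorem fderiv_apply_eq (Φ : ℝ × ℝ × ℝ → ℝ × ℝ × ℝ) (z : ℝ × ℝ × ℝ) (a b c : ℝ) :
    fderiv ℝ Φ z (a, b, c) = a • fderiv ℝ Φ z (1, 0, 0) + b • fderiv ℝ Φ z (0, 1, 0) +
      c • fderiv ℝ Φ z (0, 0, 1) := by
  rw [← map_smul, ← map_smul, ← map_smul, ← map_add, ← map_add]
  simp

/-- The Cauchy–Binet formula: the identity matrix is a product of a 2 × 3 and a 3 × 2 matrix, so its
determinant `1` is a combination of the three minors. -/
theorem minors_ne_zero {a b c a' b' c' Tt Tx Tu Xt Xx Xu : ℝ}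
    (e₁ : a * Tt + b * Tx + c * Tu = 1) (e₂ : a * Xt + b * Xx + c * Xu = 0)
    (e₃ : a' * Tt + b' * Tx + c' * Tu = 0) (e₄ : a' * Xt + b' * Xx + c' * Xu = 1) :
    ¬(Tt * Xx - Xt * Tx = 0 ∧ Tu * Xx - Xu * Tx = 0 ∧ Tt * Xu - Xt * Tu = 0) := by
  rintro ⟨h1, h2, h3⟩
  have : (a * Tt + b * Tx + c * Tu) * (a' * Xt + b' * Xx + c' * Xu) -
      (a * Xt + b * Xx + c * Xu) * (a' * Tt + b' * Tx + c' * Tu) = 0 := by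
    linear_combination (a * b' - b * a') * h1 + (c * b' - b * c') * h2 + (a * c' - c * a') * h3
  rw [e₁, e₂, e₃, e₄] at this
  norm_num at this

theorem base_minors (h : (fderiv ℝ Φ z).det ≠ 0) :
    ¬((fderiv ℝ Φ z (1, 0, 0)).1 * (fderiv ℝ Φ z (0, 1, 0)).2.1 -
        (fderiv ℝ Φ z (1, 0, 0)).2.1 * (fderiv ℝ Φ z (0, 1, 0)).1 = 0 ∧
      (fderiv ℝ Φ z (0, 0, 1)).1 * (fderiv ℝ Φ z (0, 1, 0)).2.1 -
        (fderiv ℝ Φ z (0, 0, 1)).2.1 * (fderiv ℝ Φ z (0, 1, 0)).1 = 0 ∧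
      (fderiv ℝ Φ z (1, 0, 0)).1 * (fderiv ℝ Φ z (0, 0, 1)).2.1 -
        (fderiv ℝ Φ z (1, 0, 0)).2.1 * (fderiv ℝ Φ z (0, 0, 1)).1 = 0) := by
  have hs := (clm_injective_of_det_ne_zero h).2
  obtain ⟨⟨a, b, c⟩, hy⟩ := hs (1, 0, 0)
  obtain ⟨⟨a', b', c'⟩, hy'⟩ := hs (0, 1, 0)
  rw [fderiv_apply_eq] at hy hy'
  simp only [Prod.ext_iff, Prod.fst_add, Prod.snd_add, Prod.smul_fst, Prod.smul_snd,
    smul_eq_mul] at hy hy'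
  exact minors_ne_zero hy.1 hy.2.1 hy'.1 hy'.2.1

/-- The new independent variables do not depend on `u`, and each of them depends on one of the
old ones only. -/
theorem base_derivatives (hI : IsOpen I) (hJ : IsOpen J)
    (hB : IsOpen (box T I J)) (hE : IsExtendedEquivalence T I J (genericOn I J) Φ Θ)
    (hz : z ∈ box T I J) :
    (fderiv ℝ Φ z (0, 0, 1)).1 = 0 ∧ (fderiv ℝ Φ z (0, 0, 1)).2.1 = 0 ∧
      (((fderiv ℝ Φ z (1, 0, 0)).1 = 0 ∧ (fderiv ℝ Φ z (0, 1, 0)).2.1 = 0) ∨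
        ((fderiv ℝ Φ z (1, 0, 0)).2.1 = 0 ∧ (fderiv ℝ Φ z (0, 1, 0)).1 = 0)) := by
  have hI' : I.Nonempty := ⟨_, hz.2.1⟩
  have hJ' : J.Nonempty := ⟨_, hz.2.2⟩
  refine independent_of_fiber ?_ ?_
  · exact base_minors (hE.1.2 z hz)
  · intro a b hab
    have hα : fderiv ℝ Φ z (1, 0, a) = fderiv ℝ Φ z (1, 0, 0) + a • fderiv ℝ Φ z (0, 0, 1) := by
      rw [fderiv_apply_eq]; simp
    have hβ : fderiv ℝ Φ z (0, 1, b) = fderiv ℝ Φ z (0, 1, 0) + b • fderiv ℝ Φ z (0, 0, 1) := by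
      rw [fderiv_apply_eq]; simp
    -- The constants `f = 1` and `f = 2` yield `p = q` and `2 * p = q` for the two products in
    -- question, so both vanish.
    have hg1 := generic_id_of_contDiff hJ hI' hJ' (F := fun _ => 1) contDiff_const
      (fun _ => one_ne_zero)
    have hg2 := generic_id_of_contDiff hJ hI' hJ' (F := fun _ => 2) contDiff_const
      (fun _ => two_ne_zero)
    obtain ⟨s1, -⟩ := symbol_relation hB hI hJ hE.1 hg1.1 (hE.2 _ hg1).1 (hE.2 _ hg1).2 hz hα hβ hab
    obtain ⟨s2, -⟩ := symbol_relation hB hI hJ hE.1 hg2.1 (hE.2 _ hg2).1 (hE.2 _ hg2).2 hz hα hβ hab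
    simp only [Prod.fst_add, Prod.snd_add, Prod.smul_fst, Prod.smul_snd, smul_eq_mul] at s1 s2
    constructor <;> linarith

theorem fiber_derivative_ne_zero (hI : IsOpen I) (hJ : IsOpen J)
    (hB : IsOpen (box T I J)) (hE : IsExtendedEquivalence T I J (genericOn I J) Φ Θ)
    (hz : z ∈ box T I J) : (fderiv ℝ Φ z (0, 0, 1)).2.2 ≠ 0 := by
  intro h
  obtain ⟨h1, h2, -⟩ := base_derivatives hI hJ hB hE hz
  have : fderiv ℝ Φ z (0, 0, 1) = fderiv ℝ Φ z 0 := by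
    rw [map_zero]
    exact Prod.ext h1 (Prod.ext h2 h)
  have := (clm_injective_of_det_ne_zero (hE.1.2 z hz)).1 this
  simp [Prod.ext_iff] at this

theorem base_jacobian_ne_zero (hI : IsOpen I) (hJ : IsOpen J)
    (hB : IsOpen (box T I J)) (hE : IsExtendedEquivalence T I J (genericOn I J) Φ Θ)
    (hz : z ∈ box T I J) :
    (fderiv ℝ Φ z (1, 0, 0)).1 * (fderiv ℝ Φ z (0, 1, 0)).2.1 -
      (fderiv ℝ Φ z (1, 0, 0)).2.1 * (fderiv ℝ Φ z (0, 1, 0)).1 ≠ 0 := by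
  obtain ⟨h1, h2, -⟩ := base_derivatives hI hJ hB hE hz
  intro h
  exact base_minors (hE.1.2 z hz) ⟨h, by rw [h1, h2]; ring, by rw [h1, h2]; ring⟩

/-- The same of the two cases occurs at all points of the box. -/
theorem base_dichotomy (hT' : IsPreconnected T) (hI : IsOpen I) (hI' : IsPreconnected I)
    (hJ : IsOpen J) (hJ' : IsPreconnected J) (hB : IsOpen (box T I J))
    (hE : IsExtendedEquivalence T I J (genericOn I J) Φ Θ) :
    (∀ z ∈ box T I J, (fderiv ℝ Φ z (1, 0, 0)).1 = 0 ∧ (fderiv ℝ Φ z (0, 1, 0)).2.1 = 0) ∨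
      ∀ z ∈ box T I J, (fderiv ℝ Φ z (1, 0, 0)).2.1 = 0 ∧ (fderiv ℝ Φ z (0, 1, 0)).1 = 0 := by
  have hc : ContinuousOn (fun z => fderiv ℝ Φ z (1, 0, 0)) (box T I J) :=
    (hE.1.1.continuousOn_fderiv_of_isOpen hB (by simp)).clm_apply continuousOn_const
  -- The sets where `T_t ≠ 0` and where `X_t ≠ 0` are open and disjoint and cover the connected box,
  -- so one of them is the whole box.
  have o1 : IsOpen (box T I J ∩ {z | (fderiv ℝ Φ z (1, 0, 0)).1 ≠ 0}) :=
    (continuous_fst.comp_continuousOn hc).isOpen_inter_preimage hB isOpen_compl_singleton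
  have o2 : IsOpen (box T I J ∩ {z | (fderiv ℝ Φ z (1, 0, 0)).2.1 ≠ 0}) :=
    ((continuous_fst.comp continuous_snd).comp_continuousOn hc).isOpen_inter_preimage hB
      isOpen_compl_singleton
  have hpre : IsPreconnected (box T I J) := hT'.prod (hI'.prod hJ')
  have cover : ∀ z ∈ box T I J, ((fderiv ℝ Φ z (1, 0, 0)).1 = 0 ∧
      (fderiv ℝ Φ z (1, 0, 0)).2.1 ≠ 0 ∧ (fderiv ℝ Φ z (0, 1, 0)).2.1 = 0) ∨
      ((fderiv ℝ Φ z (1, 0, 0)).2.1 = 0 ∧ (fderiv ℝ Φ z (1, 0, 0)).1 ≠ 0 ∧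
        (fderiv ℝ Φ z (0, 1, 0)).1 = 0) := by
    intro z hz
    have hj := base_jacobian_ne_zero hI hJ hB hE hz
    rcases (base_derivatives hI hJ hB hE hz).2.2 with ⟨h1, h2⟩ | ⟨h1, h2⟩
    · exact Or.inl ⟨h1, fun h => hj (by rw [h, h1]; ring), h2⟩
    · exact Or.inr ⟨h1, fun h => hj (by rw [h, h1]; ring), h2⟩
  have hdisj : Disjoint (box T I J ∩ {z | (fderiv ℝ Φ z (1, 0, 0)).1 ≠ 0})
      (box T I J ∩ {z | (fderiv ℝ Φ z (1, 0, 0)).2.1 ≠ 0}) := by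
    rw [Set.disjoint_left]
    rintro z ⟨hz, h1⟩ ⟨-, h2⟩
    rcases cover z hz with h' | h'
    · exact h1 h'.1
    · exact h2 h'.1
  have hcov : box T I J ⊆ box T I J ∩ {z | (fderiv ℝ Φ z (1, 0, 0)).1 ≠ 0} ∪
      box T I J ∩ {z | (fderiv ℝ Φ z (1, 0, 0)).2.1 ≠ 0} := by
    intro z hz
    rcases cover z hz with h' | h'
    · exact Or.inr ⟨hz, h'.2.1⟩
    · exact Or.inl ⟨hz, h'.2.1⟩
  rcases hpre.subset_or_subset o1 o2 hdisj hcov with h | h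
  · right
    intro z hz
    rcases cover z hz with h' | h'
    · exact absurd h'.1 (h hz).2
    · exact ⟨h'.1, h'.2.2⟩
  · left
    intro z hz
    rcases cover z hz with h' | h'
    · exact ⟨h'.1, h'.2.2⟩
    · exact absurd h'.1 (h hz).2

/-- A function with vanishing directional derivative is constant on segments of this direction. -/
theorem eq_of_fderiv_line {E : Type*} [NormedAddCommGroup E] [NormedSpace ℝ E] {G : E → ℝ}
    {S : Set ℝ} (hS : IsOpen S) (hS' : IsPreconnected S) {ι : ℝ → E} {e : E}
    (hι : ∀ s, HasDerivAt ι e s) (hG : ∀ s ∈ S, DifferentiableAt ℝ G (ι s))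
    (h0 : ∀ s ∈ S, fderiv ℝ G (ι s) e = 0) {s s' : ℝ} (hs : s ∈ S) (hs' : s' ∈ S) :
    G (ι s) = G (ι s') := by
  have h : ∀ s ∈ S, HasDerivAt (fun s => G (ι s)) 0 s := by
    intro s hs
    rw [← h0 s hs]
    exact (hG s hs).hasFDerivAt.comp_hasDerivAt s (hι s)
  exact hS.is_const_of_deriv_eq_zero hS' (fun s hs => (h s hs).differentiableAt.differentiableWithinAt)
    (fun s hs => (h s hs).deriv) hs hs'

theorem hasDerivAt_line₁ (x u t : ℝ) :
    HasDerivAt (fun t : ℝ => (t, x, u)) ((1, 0, 0) : ℝ × ℝ × ℝ) t :=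
  (hasDerivAt_id t).prodMk (hasDerivAt_const t (x, u))

theorem hasDerivAt_line₂ (t u x : ℝ) :
    HasDerivAt (fun x : ℝ => (t, x, u)) ((0, 1, 0) : ℝ × ℝ × ℝ) x :=
  (hasDerivAt_const x t).prodMk ((hasDerivAt_id x).prodMk (hasDerivAt_const x u))

theorem hasDerivAt_line₃ (t x u : ℝ) :
    HasDerivAt (fun u : ℝ => (t, x, u)) ((0, 0, 1) : ℝ × ℝ × ℝ) u :=
  (hasDerivAt_const u t).prodMk ((hasDerivAt_const u x).prodMk (hasDerivAt_id u))

theorem fderiv_clm_comp {E F G : Type*} [NormedAddCommGroup E] [NormedSpace ℝ E]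
    [NormedAddCommGroup F] [NormedSpace ℝ F] [NormedAddCommGroup G] [NormedSpace ℝ G]
    {f : E → F} {p : E} (L : F →L[ℝ] G) (hf : DifferentiableAt ℝ f p) (e : E) :
    DifferentiableAt ℝ (fun q => L (f q)) p ∧ fderiv ℝ (fun q => L (f q)) p e = L (fderiv ℝ f p e) := by
  have := L.hasFDerivAt.comp p hf.hasFDerivAt
  exact ⟨this.differentiableAt, congrArg (fun A : E →L[ℝ] G => A e) this.fderiv⟩

/-- If a function of `ũ` does not depend on `u`, it is constant. -/
theorem comp_fiber_const (hB : IsOpen (box T I J)) (hB' : IsPreconnected (box T I J))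
    (hJ : IsOpen J) {N : ℝ → ℝ} (hΦ : IsPointTransformation T I J Φ)
    (hN : ContDiffOn ℝ ∞ N (uImage T I J Φ))
    (hu : ∀ z ∈ box T I J, (fderiv ℝ Φ z (0, 0, 1)).2.2 ≠ 0)
    (h : ∀ t x u u', (t, x, u) ∈ box T I J → (t, x, u') ∈ box T I J →
      N (Φ (t, x, u)).2.2 = N (Φ (t, x, u')).2.2) {z z' : ℝ × ℝ × ℝ} (hz : z ∈ box T I J)
    (hz' : z' ∈ box T I J) : N (Φ z).2.2 = N (Φ z').2.2 := by
  have hd : ∀ z ∈ box T I J, HasFDerivAt (fun z => N (Φ z).2.2)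
      (deriv N (Φ z).2.2 • fiberProj.comp (fderiv ℝ Φ z)) z := by
    intro z hz
    have h1 := ((hN.contDiffAt (hΦ.uImage_mem_nhds hB hz)).differentiableAt (by simp)).hasDerivAt
    exact h1.comp_hasFDerivAt z (fiberProj.hasFDerivAt.comp z
      ((hΦ.contDiffAt hB hz).differentiableAt (by simp)).hasFDerivAt)
  have h0 : ∀ z ∈ box T I J, deriv N (Φ z).2.2 = 0 := by
    rintro ⟨t, x, u⟩ hz
    have h1 := (hd _ hz).comp_hasDerivAt u (hasDerivAt_line₃ t x u)
    have h2 : (fun u => N (Φ (t, x, u)).2.2) =ᶠ[𝓝 u] fun _ => N (Φ (t, x, u)).2.2 := by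
      filter_upwards [hJ.mem_nhds hz.2.2] with u' hu'
      exact h t x u' u ⟨hz.1, hz.2.1, hu'⟩ hz
    have h3 := h1.unique ((hasDerivAt_const u _).congr_of_eventuallyEq h2)
    exact (mul_eq_zero.1 h3).resolve_right (hu _ hz)
  refine hB.is_const_of_fderiv_eq_zero hB'
    (fun z hz => (hd z hz).differentiableAt.differentiableWithinAt) (fun z hz => ?_) hz hz'
  rw [(hd z hz).fderiv, h0 z hz, zero_smul]
  rfl

end

/-! ### The form of the transformation of variables -/

theorem exists_ne_mem {S : Set ℝ} (hS : IsOpen S) {x : ℝ} (hx : x ∈ S) : ∃ y ∈ S, y ≠ x := by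
  have h1 : ∀ᶠ y in 𝓝[≠] x, y ∈ S := nhdsWithin_le_nhds (hS.mem_nhds hx)
  have h2 : ∀ᶠ y in 𝓝[≠] x, y ≠ x := eventually_mem_nhdsWithin
  exact (h1.and h2).exists

/-- The projection to the coordinate `t̃`. -/
def coord₁ : ℝ × ℝ × ℝ →L[ℝ] ℝ := ContinuousLinearMap.fst ℝ ℝ (ℝ × ℝ)

/-- The projection to the coordinate `x̃`. -/
def coord₂ : ℝ × ℝ × ℝ →L[ℝ] ℝ :=
  (ContinuousLinearMap.fst ℝ ℝ ℝ).comp (ContinuousLinearMap.snd ℝ ℝ (ℝ × ℝ))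

section

variable {T I J : Set ℝ} {Φ : ℝ × ℝ × ℝ → ℝ × ℝ × ℝ} {Θ : Elements → Elements}

theorem hasDerivAt_clm_line (hB : IsOpen (box T I J)) (hΦ : IsPointTransformation T I J Φ)
    (L : ℝ × ℝ × ℝ →L[ℝ] ℝ) {ι : ℝ → ℝ × ℝ × ℝ} {e : ℝ × ℝ × ℝ} {s : ℝ} (hι : HasDerivAt ι e s)
    (hs : ι s ∈ box T I J) :
    HasDerivAt (fun s => L (Φ (ι s))) (L (fderiv ℝ Φ (ι s) e)) s :=
  L.hasFDerivAt.comp_hasDerivAt s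
    (((hΦ.contDiffAt hB hs).differentiableAt (by simp)).hasFDerivAt.comp_hasDerivAt s hι)

theorem eq_of_clm_line (hB : IsOpen (box T I J)) (hΦ : IsPointTransformation T I J Φ)
    (L : ℝ × ℝ × ℝ →L[ℝ] ℝ) {S : Set ℝ} (hS : IsOpen S) (hS' : IsPreconnected S)
    {ι : ℝ → ℝ × ℝ × ℝ} {e : ℝ × ℝ × ℝ} (hι : ∀ s, HasDerivAt ι e s)
    (hm : ∀ s ∈ S, ι s ∈ box T I J) (h0 : ∀ z ∈ box T I J, L (fderiv ℝ Φ z e) = 0) {s s' : ℝ}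
    (hs : s ∈ S) (hs' : s' ∈ S) : L (Φ (ι s)) = L (Φ (ι s')) := by
  have hd := fun s hs => fderiv_clm_comp L
    ((hΦ.contDiffAt hB (hm s hs)).differentiableAt (by simp)) e
  exact eq_of_fderiv_line hS hS' (G := fun z => L (Φ z)) hι (fun s hs => (hd s hs).1)
    (fun s hs => by rw [(hd s hs).2, h0 _ (hm s hs)]) hs hs'

/-- Differentiation of an identity between the values of a component of `Φ` on two parallel lines.
It transfers independence of a variable from a component to its partial derivative. -/
theorem clm_line_deriv_eq (hB : IsOpen (box T I J)) (hΦ : IsPointTransformation T I J Φ)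
    (L : ℝ × ℝ × ℝ →L[ℝ] ℝ) {S : Set ℝ} (hS : IsOpen S) {ι ι' : ℝ → ℝ × ℝ × ℝ} {e : ℝ × ℝ × ℝ}
    (hι : ∀ s, HasDerivAt ι e s) (hι' : ∀ s, HasDerivAt ι' e s)
    (hm : ∀ s ∈ S, ι s ∈ box T I J) (hm' : ∀ s ∈ S, ι' s ∈ box T I J)
    (h : ∀ s ∈ S, L (Φ (ι s)) = L (Φ (ι' s))) {s : ℝ} (hs : s ∈ S) :
    L (fderiv ℝ Φ (ι s) e) = L (fderiv ℝ Φ (ι' s) e) := by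
  refine (hasDerivAt_clm_line hB hΦ L (hι s) (hm s hs)).unique
    ((hasDerivAt_clm_line hB hΦ L (hι' s) (hm' s hs)).congr_of_eventuallyEq ?_)
  filter_upwards [hS.mem_nhds hs] with s hs using h s hs

variable (hT : IsOpen T) (hT' : IsPreconnected T) (hI : IsOpen I) (hI' : IsPreconnected I)
  (hJ : IsOpen J) (hJ' : IsPreconnected J)

include hT hT' hI hI' hJ hJ' in
/-- The variables `t` and `x` are not interchanged. -/
theorem not_interchanged (hne : (box T I J).Nonempty)
    (hE : IsExtendedEquivalence T I J (genericOn I J) Φ Θ)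
    (h : ∀ z ∈ box T I J, (fderiv ℝ Φ z (1, 0, 0)).1 = 0 ∧ (fderiv ℝ Φ z (0, 1, 0)).2.1 = 0) :
    False := by
  have hB := isOpen_box hT hI hJ
  obtain ⟨⟨t, x, u⟩, ht, hx, hu⟩ := hne
  have hD := fun z (hz : z ∈ box T I J) => base_derivatives hI hJ hB hE hz
  -- In the interchanged case `x̃` depends on `t` only, so along a line in the direction of `x` all
  -- new arbitrary elements in the symbol relation are constant, once `θ'.H` is known to be
  -- constant. The constant `k` may depend on `F`, but the right-hand side does not.
  have key : ∀ F : ℝ → ℝ, ContDiff ℝ ∞ F → (∀ x, F x ≠ 0) →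
      ∃ k : ℝ, k ≠ 0 ∧ ∀ x' ∈ I, F x' * k = (fderiv ℝ Φ (t, x', u) (0, 1, 0)).1 ^ 2 := by
    intro F hF hF0
    have hg := generic_id_of_contDiff hJ ⟨x, hx⟩ ⟨u, hu⟩ hF hF0
    obtain ⟨hc, ht'⟩ := hE.2 _ hg
    set θ' := Θ ⟨F, fun _ => 1, fun _ => 1, fun _ => 1, fun u => u⟩
    have rel : ∀ z ∈ box T I J,
        F z.2.1 * (fderiv ℝ Φ z (1, 0, 0)).2.1 ^ 2 * θ'.f (Φ z).2.1 =
          (fderiv ℝ Φ z (0, 1, 0)).1 ^ 2 * θ'.g (Φ z).2.1 * θ'.H (Φ z).2.2 := by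
      intro z hz
      have h1 := (symbol_relation hB hI hJ hE.1 hg.1 hc ht' hz rfl rfl
        (base_jacobian_ne_zero hI hJ hB hE hz)).2
      rw [(h z hz).1, (h z hz).2] at h1
      linear_combination h1
    have hXu : ∀ t' ∈ T, ∀ x' ∈ I, ∀ x'' ∈ I, ∀ u' ∈ J, ∀ u'' ∈ J,
        coord₂ (Φ (t', x', u')) = coord₂ (Φ (t', x'', u'')) := by
      intro t' ht' x' hx' x'' hx'' u' hu' u'' hu''
      rw [eq_of_clm_line hB hE.1 coord₂ hI hI' (hasDerivAt_line₂ t' u')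
        (fun s hs => ⟨ht', hs, hu'⟩) (fun z hz => (h z hz).2) hx' hx'']
      exact eq_of_clm_line hB hE.1 coord₂ hJ hJ' (hasDerivAt_line₃ t' x'')
        (fun s hs => ⟨ht', hx'', hs⟩) (fun z hz => (hD z hz).2.1) hu' hu''
    have hTu : ∀ t' ∈ T, ∀ x' ∈ I, ∀ u' ∈ J, ∀ u'' ∈ J,
        coord₁ (Φ (t', x', u')) = coord₁ (Φ (t', x', u'')) := by
      intro t' ht' x' hx' u' hu' u'' hu''
      exact eq_of_clm_line hB hE.1 coord₁ hJ hJ' (hasDerivAt_line₃ t' x')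
        (fun s hs => ⟨ht', hx', hs⟩) (fun z hz => (hD z hz).1) hu' hu''
    have hXt : ∀ t' ∈ T, ∀ x' ∈ I, ∀ x'' ∈ I, ∀ u' ∈ J, ∀ u'' ∈ J,
        (fderiv ℝ Φ (t', x', u') (1, 0, 0)).2.1 = (fderiv ℝ Φ (t', x'', u'') (1, 0, 0)).2.1 := by
      intro t' ht' x' hx' x'' hx'' u' hu' u'' hu''
      exact clm_line_deriv_eq hB hE.1 coord₂ hT (hasDerivAt_line₁ x' u') (hasDerivAt_line₁ x'' u'')
        (fun s hs => ⟨hs, hx', hu'⟩) (fun s hs => ⟨hs, hx'', hu''⟩)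
        (fun s hs => hXu s hs x' hx' x'' hx'' u' hu' u'' hu'') ht'
    have hTx : ∀ t' ∈ T, ∀ x' ∈ I, ∀ u' ∈ J, ∀ u'' ∈ J,
        (fderiv ℝ Φ (t', x', u') (0, 1, 0)).1 = (fderiv ℝ Φ (t', x', u'') (0, 1, 0)).1 := by
      intro t' ht' x' hx' u' hu' u'' hu''
      exact clm_line_deriv_eq hB hE.1 coord₁ hI (hasDerivAt_line₂ t' u') (hasDerivAt_line₂ t' u'')
        (fun s hs => ⟨ht', hs, hu'⟩) (fun s hs => ⟨ht', hs, hu''⟩)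
        (fun s hs => hTu t' ht' s hs u' hu' u'' hu'') hx'
    have nz : ∀ z ∈ box T I J, (fderiv ℝ Φ z (0, 1, 0)).1 ≠ 0 ∧
        (fderiv ℝ Φ z (1, 0, 0)).2.1 ≠ 0 := by
      intro z hz
      have := base_jacobian_ne_zero hI hJ hB hE hz
      rw [(h z hz).1, (h z hz).2] at this
      constructor <;> intro h0 <;> simp [h0] at this
    have xm : ∀ z ∈ box T I J, (Φ z).2.1 ∈ xImage T I J Φ := fun z hz => ⟨z, hz, rfl⟩
    have um : ∀ z ∈ box T I J, (Φ z).2.2 ∈ uImage T I J Φ := fun z hz => ⟨z, hz, rfl⟩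
    have hz0 : (t, x, u) ∈ box T I J := ⟨ht, hx, hu⟩
    -- At fixed `t` and `x` every other factor in `rel` is independent of `u`, because the test
    -- equation has `H = 1`.
    have hN : ∀ z ∈ box T I J, θ'.H (Φ z).2.2 = θ'.H (Φ (t, x, u)).2.2 := by
      intro z hz
      refine comp_fiber_const hB (hT'.prod (hI'.prod hJ')) hJ hE.1 hc.2.2.2.1
        (fun z hz => fiber_derivative_ne_zero hI hJ hB hE hz) ?_ hz hz0
      intro t' x' u' u'' hz' hz''
      have r1 := rel _ hz'
      have r2 := rel _ hz''
      have e1 : (Φ (t', x', u')).2.1 = (Φ (t', x', u'')).2.1 :=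
        hXu t' hz'.1 x' hz'.2.1 x' hz'.2.1 u' hz'.2.2 u'' hz''.2.2
      rw [hXt t' hz'.1 x' hz'.2.1 x' hz'.2.1 u' hz'.2.2 u'' hz''.2.2, e1,
        hTx t' hz'.1 x' hz'.2.1 u' hz'.2.2 u'' hz''.2.2] at r1
      simp only at r1 r2
      rw [r2] at r1
      exact (mul_left_cancel₀ (mul_ne_zero (pow_ne_zero 2 (nz _ hz'').1)
        (hc.2.2.2.2.2.2.1 _ (xm _ hz''))) r1).symm
    have hg0 := hc.2.2.2.2.2.2.1 _ (xm _ hz0)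
    have hH0 := hc.2.2.2.2.2.2.2.1 _ (um _ hz0)
    have hf0 := hc.2.2.2.2.2.1 _ (xm _ hz0)
    refine ⟨(fderiv ℝ Φ (t, x, u) (1, 0, 0)).2.1 ^ 2 * θ'.f (Φ (t, x, u)).2.1 /
      (θ'.g (Φ (t, x, u)).2.1 * θ'.H (Φ (t, x, u)).2.2), ?_, fun x' hx' => ?_⟩
    · exact div_ne_zero (mul_ne_zero (pow_ne_zero 2 (nz _ hz0).2) hf0) (mul_ne_zero hg0 hH0)
    · have r := rel (t, x', u) ⟨ht, hx', hu⟩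
      have e1 : (Φ (t, x', u)).2.1 = (Φ (t, x, u)).2.1 := hXu t ht x' hx' x hx u hu u hu
      rw [hXt t ht x' hx' x hx u hu u hu, e1, hN (t, x', u) ⟨ht, hx', hu⟩] at r
      field_simp
      linear_combination r
  -- `f = 1` shows that `T_x ^ 2` is constant in `x`; then `f = exp` would make `exp` constant on
  -- `I`.
  obtain ⟨k₁, hk₁, h₁⟩ := key (fun _ => 1) contDiff_const fun _ => one_ne_zero
  obtain ⟨k₂, hk₂, h₂⟩ := key Real.exp Real.contDiff_exp Real.exp_ne_zero
  obtain ⟨y, hy, hyx⟩ := exists_ne_mem hI hx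
  have e : Real.exp y * k₂ = Real.exp x * k₂ := by rw [h₂ y hy, h₂ x hx, ← h₁ y hy, ← h₁ x hx]
  exact hyx (Real.exp_injective (mul_right_cancel₀ hk₂ e))

include hT hT' hI hI' hJ hJ' in
/-- The form of the transformation of variables, except for the affinity in `u`. -/
theorem exists_variable_form (hne : (box T I J).Nonempty)
    (hE : IsExtendedEquivalence T I J (genericOn I J) Φ Θ) :
    ∃ (δ₁ δ₂ : ℝ) (ξ μ : ℝ → ℝ), δ₁ ≠ 0 ∧ ContDiffOn ℝ ∞ ξ I ∧ (∀ x ∈ I, deriv ξ x ≠ 0) ∧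
      ContDiffOn ℝ ∞ μ J ∧ (∀ u ∈ J, deriv μ u ≠ 0) ∧
      ∀ z ∈ box T I J, Φ z = (δ₁ * z.1 + δ₂, ξ z.2.1, μ z.2.2) := by
  have hB := isOpen_box hT hI hJ
  have hD := fun z (hz : z ∈ box T I J) => base_derivatives hI hJ hB hE hz
  have h : ∀ z ∈ box T I J, (fderiv ℝ Φ z (1, 0, 0)).2.1 = 0 ∧ (fderiv ℝ Φ z (0, 1, 0)).1 = 0 :=
    (base_dichotomy hT' hI hI' hJ hJ' hB hE).resolve_left
      fun h => not_interchanged hT hT' hI hI' hJ hJ' hne hE h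
  obtain ⟨⟨t, x, u⟩, ht, hx, hu⟩ := hne
  have hz0 : (t, x, u) ∈ box T I J := ⟨ht, hx, hu⟩
  set τ : ℝ → ℝ := fun s => (Φ (s, x, u)).1 with hτ
  set ξ : ℝ → ℝ := fun s => (Φ (t, s, u)).2.1 with hξ
  set μ : ℝ → ℝ := fun s => (Φ (t, x, s)).2.2 with hμ
  have hTτ : ∀ t' ∈ T, ∀ x' ∈ I, ∀ u' ∈ J, (Φ (t', x', u')).1 = τ t' := by
    intro t' ht' x' hx' u' hu'
    have e1 : coord₁ (Φ (t', x', u')) = coord₁ (Φ (t', x, u')) :=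
      eq_of_clm_line hB hE.1 coord₁ hI hI' (hasDerivAt_line₂ t' u')
        (fun s hs => ⟨ht', hs, hu'⟩) (fun z hz => (h z hz).2) hx' hx
    have e2 : coord₁ (Φ (t', x, u')) = coord₁ (Φ (t', x, u)) :=
      eq_of_clm_line hB hE.1 coord₁ hJ hJ' (hasDerivAt_line₃ t' x)
        (fun s hs => ⟨ht', hx, hs⟩) (fun z hz => (hD z hz).1) hu' hu
    exact e1.trans e2
  have hXξ : ∀ t' ∈ T, ∀ x' ∈ I, ∀ u' ∈ J, (Φ (t', x', u')).2.1 = ξ x' := by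
    intro t' ht' x' hx' u' hu'
    have e1 : coord₂ (Φ (t', x', u')) = coord₂ (Φ (t, x', u')) :=
      eq_of_clm_line hB hE.1 coord₂ hT hT' (hasDerivAt_line₁ x' u')
        (fun s hs => ⟨hs, hx', hu'⟩) (fun z hz => (h z hz).1) ht' ht
    have e2 : coord₂ (Φ (t, x', u')) = coord₂ (Φ (t, x', u)) :=
      eq_of_clm_line hB hE.1 coord₂ hJ hJ' (hasDerivAt_line₃ t x')
        (fun s hs => ⟨ht, hx', hs⟩) (fun z hz => (hD z hz).2.1) hu' hu
    exact e1.trans e2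
  have hτ' : ∀ t' ∈ T, ∀ x' ∈ I, ∀ u' ∈ J,
      HasDerivAt τ (fderiv ℝ Φ (t', x', u') (1, 0, 0)).1 t' := by
    intro t' ht' x' hx' u' hu'
    refine (hasDerivAt_clm_line hB hE.1 coord₁ (hasDerivAt_line₁ x' u' t')
      ⟨ht', hx', hu'⟩).congr_of_eventuallyEq ?_
    filter_upwards [hT.mem_nhds ht'] with s hs using (hTτ s hs x' hx' u' hu').symm
  have hξ' : ∀ t' ∈ T, ∀ x' ∈ I, ∀ u' ∈ J,
      HasDerivAt ξ (fderiv ℝ Φ (t', x', u') (0, 1, 0)).2.1 x' := by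
    intro t' ht' x' hx' u' hu'
    refine (hasDerivAt_clm_line hB hE.1 coord₂ (hasDerivAt_line₂ t' u' x')
      ⟨ht', hx', hu'⟩).congr_of_eventuallyEq ?_
    filter_upwards [hI.mem_nhds hx'] with s hs using (hXξ t' ht' s hs u' hu').symm
  have nz : ∀ t' ∈ T, ∀ x' ∈ I, deriv τ t' ≠ 0 ∧ deriv ξ x' ≠ 0 := by
    intro t' ht' x' hx'
    have hz : (t', x', u) ∈ box T I J := ⟨ht', hx', hu⟩
    have := base_jacobian_ne_zero hI hJ hB hE hz
    rw [(h _ hz).1, zero_mul, sub_zero, ← (hτ' t' ht' x' hx' u hu).deriv,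
      ← (hξ' t' ht' x' hx' u hu).deriv] at this
    exact ⟨left_ne_zero_of_mul this, right_ne_zero_of_mul this⟩
  have rel : ∀ θ ∈ genericOn I J, ∀ t' ∈ T, ∀ x' ∈ I, ∀ u' ∈ J,
      θ.f x' * deriv τ t' ^ 2 * ((Θ θ).g (ξ x') * (Θ θ).H (Φ (t', x', u')).2.2) =
        θ.g x' * θ.H u' * deriv ξ x' ^ 2 * (Θ θ).f (ξ x') := by
    intro θ hθ t' ht' x' hx' u' hu'
    have hz : (t', x', u') ∈ box T I J := ⟨ht', hx', hu'⟩
    have h1 := (symbol_relation hB hI hJ hE.1 hθ.1 (hE.2 _ hθ).1 (hE.2 _ hθ).2 hz rfl rfl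
      (base_jacobian_ne_zero hI hJ hB hE hz)).2
    rw [(h _ hz).1, (h _ hz).2, ← (hτ' t' ht' x' hx' u' hu').deriv,
      ← (hξ' t' ht' x' hx' u' hu').deriv] at h1
    simp only [hXξ t' ht' x' hx' u' hu'] at h1
    linear_combination h1
  have xm : ∀ x' ∈ I, ξ x' ∈ xImage T I J Φ := fun x' hx' => ⟨(t, x', u), ⟨ht, hx', hu⟩, rfl⟩
  have um : ∀ z ∈ box T I J, (Φ z).2.2 ∈ uImage T I J Φ := fun z hz => ⟨z, hz, rfl⟩
  have hτc : ContDiffOn ℝ ∞ τ T := by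
    have h1 : ContDiffOn ℝ ∞ (fun s : ℝ => (s, x, u)) T := by fun_prop
    exact coord₁.contDiff.comp_contDiffOn (hE.1.1.comp h1 fun s hs => ⟨hs, hx, hu⟩)
  have hξc : ContDiffOn ℝ ∞ ξ I := by
    have h1 : ContDiffOn ℝ ∞ (fun s : ℝ => (t, s, u)) I := by fun_prop
    exact coord₂.contDiff.comp_contDiffOn (hE.1.1.comp h1 fun s hs => ⟨ht, hs, hu⟩)
  have hμc : ContDiffOn ℝ ∞ μ J := by
    have h1 : ContDiffOn ℝ ∞ (fun s : ℝ => (t, x, s)) J := by fun_prop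
    exact fiberProj.contDiff.comp_contDiffOn (hE.1.1.comp h1 fun s hs => ⟨ht, hx, hs⟩)
  -- the derivative of `τ` is constant
  have hτ2 : ∀ t' ∈ T, deriv τ t' = deriv τ t := by
    have hg := generic_id_of_contDiff hJ ⟨x, hx⟩ ⟨u, hu⟩ (F := fun _ => 1) contDiff_const
      (fun _ => one_ne_zero)
    have r := rel _ hg
    obtain ⟨hc, -⟩ := hE.2 _ hg
    set θ' := Θ ⟨fun _ => 1, fun _ => 1, fun _ => 1, fun _ => 1, fun u => u⟩
    have hN : ∀ z ∈ box T I J, θ'.H (Φ z).2.2 = θ'.H (Φ (t, x, u)).2.2 := by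
      intro z hz
      refine comp_fiber_const hB (hT'.prod (hI'.prod hJ')) hJ hE.1 hc.2.2.2.1
        (fun z hz => fiber_derivative_ne_zero hI hJ hB hE hz) ?_ hz hz0
      intro t' x' u' u'' hz' hz''
      have r1 := r t' hz'.1 x' hz'.2.1 u' hz'.2.2
      have r2 := r t' hz'.1 x' hz'.2.1 u'' hz''.2.2
      simp only [one_mul] at r1 r2
      exact mul_left_cancel₀ (hc.2.2.2.2.2.2.1 _ (xm _ hz'.2.1)) (mul_left_cancel₀
        (pow_ne_zero 2 (nz t' hz'.1 x' hz'.2.1).1) (r1.trans r2.symm))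
    -- The symbol relation determines only the square of `deriv τ`. Continuity on the connected set
    -- `T` and a nonzero value fix the sign.
    refine hT'.eq_of_sq_eq (hτc.continuousOn_deriv_of_isOpen hT (by simp)) continuousOn_const
      (fun t' ht' => ?_) (fun _ => (nz t ht x hx).1) ht rfl
    have r1 := r t' ht' x hx u hu
    have r2 := r t ht x hx u hu
    rw [hN (t', x, u) ⟨ht', hx, hu⟩] at r1
    simp only [one_mul] at r1 r2
    exact mul_right_cancel₀ (mul_ne_zero (hc.2.2.2.2.2.2.1 _ (xm _ hx))
      (hc.2.2.2.2.2.2.2.1 _ (um _ hz0))) (r1.trans r2.symm)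
  -- the relations between the derivatives of `ũ`
  have sep : ∀ H : ℝ → ℝ, ContDiff ℝ ∞ H → (∀ u, H u ≠ 0) → (∃ u ∈ J, deriv H u ≠ 0) →
      ∀ x' ∈ I, ∃ b b' : ℝ, b ≠ 0 ∧ ∀ t' ∈ T, ∀ u' ∈ J,
        b * deriv H u' * (fderiv ℝ Φ (t', x', u') (0, 1, 0)).2.2 =
          b' * H u' * (fderiv ℝ Φ (t', x', u') (0, 0, 1)).2.2 ∧
        (deriv H u' ≠ 0 → (fderiv ℝ Φ (t', x', u') (1, 0, 0)).2.2 = 0) := by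
    rintro H hH hH0 ⟨u₁, hu₁, hd⟩ x' hx'
    have hg := generic_of_deriv hJ ⟨x, hx⟩ (F := fun _ => 1) contDiff_const (fun _ => one_ne_zero)
      hH hH0 hu₁ hd
    have r := rel _ hg
    obtain ⟨hc, -⟩ := hE.2 _ hg
    set θ' := Θ ⟨fun _ => 1, fun _ => 1, fun _ => 1, H, fun _ => 1⟩
    -- As `deriv τ` is constant, the symbol relation separates: the new `H`, taken at `ũ`, is `b x *
    -- H u` and is independent of `t`.
    set b : ℝ → ℝ := fun y => θ'.H (Φ (t, y, u)).2.2 / H u with hb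
    have hNb : ∀ t' ∈ T, ∀ y ∈ I, ∀ u' ∈ J, θ'.H (Φ (t', y, u')).2.2 = b y * H u' := by
      intro t' ht' y hy u' hu'
      have r1 := r t' ht' y hy u' hu'
      have r2 := r t ht y hy u hu
      rw [hτ2 t' ht'] at r1
      simp only [one_mul] at r1 r2
      have e : θ'.H (Φ (t', y, u')).2.2 * H u = θ'.H (Φ (t, y, u)).2.2 * H u' := by
        refine mul_left_cancel₀ (hc.2.2.2.2.2.2.1 _ (xm _ hy)) (mul_left_cancel₀
          (pow_ne_zero 2 (nz t ht y hy).1) ?_)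
        linear_combination H u * r1 - H u' * r2
      rw [hb]
      have := hH0 u
      field_simp
      exact e
    have hNd : ∀ z ∈ box T I J, HasDerivAt θ'.H (deriv θ'.H (Φ z).2.2) (Φ z).2.2 := fun z hz =>
      ((hc.2.2.2.1.contDiffAt (hE.1.uImage_mem_nhds hB hz)).differentiableAt (by simp)).hasDerivAt
    have hbd : HasDerivAt b (deriv b x') x' := by
      have h1 := (hNd (t, x', u) ⟨ht, hx', hu⟩).comp x' (hasDerivAt_clm_line hB hE.1 fiberProj
        (hasDerivAt_line₂ t u x') ⟨ht, hx', hu⟩)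
      exact (h1.div_const (H u)).differentiableAt.hasDerivAt
    have hb0 : b x' ≠ 0 := div_ne_zero (hc.2.2.2.2.2.2.2.1 _ (um _ ⟨ht, hx', hu⟩)) (hH0 u)
    refine ⟨b x', deriv b x', hb0, fun t' ht' u' hu' => ?_⟩
    have hz : (t', x', u') ∈ box T I J := ⟨ht', hx', hu'⟩
    have d1 := (hNd _ hz).comp t' (hasDerivAt_clm_line hB hE.1 fiberProj
      (hasDerivAt_line₁ x' u' t') hz)
    have d2 := (hNd _ hz).comp x' (hasDerivAt_clm_line hB hE.1 fiberProj
      (hasDerivAt_line₂ t' u' x') hz)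
    have d3 := (hNd _ hz).comp u' (hasDerivAt_clm_line hB hE.1 fiberProj
      (hasDerivAt_line₃ t' x' u') hz)
    -- The factorization is differentiated in `t`, `x` and `u`. Eliminating the unknown derivative
    -- of `θ'.H` leaves relations between the partial derivatives of `ũ` only.
    have e1 := d1.unique ((hasDerivAt_const t' (b x' * H u')).congr_of_eventuallyEq (by
      filter_upwards [hT.mem_nhds ht'] with s hs using hNb s hs x' hx' u' hu'))
    have e2 := d2.unique ((hbd.mul_const (H u')).congr_of_eventuallyEq (by
      filter_upwards [hI.mem_nhds hx'] with s hs using hNb t' ht' s hs u' hu'))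
    have e3 := d3.unique (((hH.differentiable (by simp) u').hasDerivAt.const_mul
      (b x')).congr_of_eventuallyEq (by
      filter_upwards [hJ.mem_nhds hu'] with s hs using hNb t' ht' x' hx' s hs))
    simp only [fiberProj_apply] at e1 e2 e3
    constructor
    · linear_combination (fderiv ℝ Φ (t', x', u') (0, 0, 1)).2.2 * e2 -
        (fderiv ℝ Φ (t', x', u') (0, 1, 0)).2.2 * e3
    · intro hd'
      refine (mul_eq_zero.1 e1).resolve_left fun h0 => ?_
      rw [h0, zero_mul] at e3
      exact mul_ne_zero hb0 hd' e3.symm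
  have hUt : ∀ z ∈ box T I J, (fderiv ℝ Φ z (1, 0, 0)).2.2 = 0 := by
    rintro ⟨t', x', u'⟩ ⟨ht', hx', hu'⟩
    obtain ⟨b, b', -, hbb⟩ := sep Real.exp Real.contDiff_exp Real.exp_ne_zero
      ⟨u, hu, by simp [Real.exp_ne_zero]⟩ x' hx'
    exact (hbb t' ht' u' hu').2 (by simp [Real.exp_ne_zero])
  have hUx : ∀ z ∈ box T I J, (fderiv ℝ Φ z (0, 1, 0)).2.2 = 0 := by
    rintro ⟨t', x', u'⟩ ⟨ht', hx', hu'⟩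
    have hder : ∀ u : ℝ, deriv (fun u => Real.exp (u ^ 2)) u = Real.exp (u ^ 2) * (2 * u) := by
      intro u
      simp
    obtain ⟨u₁, hu₁, hu₁'⟩ : ∃ u ∈ J, u ≠ 0 := by
      by_cases h0 : u = 0
      · subst h0; exact exists_ne_mem hJ hu
      · exact ⟨u, hu, h0⟩
    obtain ⟨b, b', hb, hbb⟩ := sep Real.exp Real.contDiff_exp Real.exp_ne_zero
      ⟨u, hu, by simp [Real.exp_ne_zero]⟩ x' hx'
    obtain ⟨c, c', hc, hcc⟩ := sep (fun u => Real.exp (u ^ 2))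
      (Real.contDiff_exp.comp (contDiff_id.pow 2)) (fun _ => Real.exp_ne_zero _)
      ⟨u₁, hu₁, by rw [hder]; exact mul_ne_zero (Real.exp_ne_zero _) (by simpa using hu₁')⟩ x' hx'
    -- The tests `exp u` and `exp (u ^ 2)` have logarithmic derivatives `1` and `2 * u`. Both
    -- express `U_x` through the nonzero `U_u`, and the resulting identity, affine in `v`, forces
    -- `b' = 0`.
    have lin : ∀ v ∈ J, c * (2 * v) * b' = c' * b := by
      intro v hv
      have e1 := (hbb t' ht' v hv).1
      have e2 := (hcc t' ht' v hv).1
      rw [Real.deriv_exp] at e1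
      rw [hder] at e2
      have hn := fiber_derivative_ne_zero hI hJ hB hE (z := (t', x', v)) ⟨ht', hx', hv⟩
      refine mul_right_cancel₀ hn (mul_right_cancel₀ (Real.exp_ne_zero v)
        (mul_right_cancel₀ (Real.exp_ne_zero (v ^ 2)) ?_))
      linear_combination (-c * (2 * v) * Real.exp (v ^ 2)) * e1 + b * Real.exp v * e2
    obtain ⟨w, hw, hwu⟩ := exists_ne_mem hJ hu'
    have hb' : b' = 0 := by
      have e : (c * (w - u')) * b' = 0 := by
        linear_combination (lin w hw - lin u' hu') / 2
      exact (mul_eq_zero.1 e).resolve_left (mul_ne_zero hc (sub_ne_zero.2 hwu))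
    have e1 := (hbb t' ht' u' hu').1
    rw [hb', zero_mul, zero_mul, Real.deriv_exp] at e1
    exact (mul_eq_zero.1 e1).resolve_left (mul_ne_zero hb (Real.exp_ne_zero _))
  have hUμ : ∀ t' ∈ T, ∀ x' ∈ I, ∀ u' ∈ J, (Φ (t', x', u')).2.2 = μ u' := by
    intro t' ht' x' hx' u' hu'
    have e1 : fiberProj (Φ (t', x', u')) = fiberProj (Φ (t, x', u')) :=
      eq_of_clm_line hB hE.1 fiberProj hT hT' (hasDerivAt_line₁ x' u')
        (fun s hs => ⟨hs, hx', hu'⟩) hUt ht' ht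
    have e2 : fiberProj (Φ (t, x', u')) = fiberProj (Φ (t, x, u')) :=
      eq_of_clm_line hB hE.1 fiberProj hI hI' (hasDerivAt_line₂ t u')
        (fun s hs => ⟨ht, hs, hu'⟩) hUx hx' hx
    exact e1.trans e2
  refine ⟨deriv τ t, τ t - deriv τ t * t, ξ, μ, (nz t ht x hx).1, hξc,
    fun x' hx' => (nz t ht x' hx').2, hμc, fun u' hu' => ?_, ?_⟩
  · have := hasDerivAt_clm_line hB hE.1 fiberProj (hasDerivAt_line₃ t x u') ⟨ht, hx, hu'⟩
    have hn := fiber_derivative_ne_zero hI hJ hB hE (z := (t, x, u')) ⟨ht, hx, hu'⟩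
    have e : HasDerivAt μ _ u' := this
    rw [e.deriv]
    exact hn
  · rintro ⟨t', x', u'⟩ ⟨ht', hx', hu'⟩
    refine Prod.ext ?_ (Prod.ext (hXξ t' ht' x' hx' u' hu') (hUμ t' ht' x' hx' u' hu'))
    rw [hTτ t' ht' x' hx' u' hu']
    have hd : ∀ s ∈ T, HasDerivAt (fun s => τ s - deriv τ t * s) 0 s := by
      intro s hs
      have h1 := (hτ' s hs x hx u hu).differentiableAt.hasDerivAt.sub
        ((hasDerivAt_id s).const_mul (deriv τ t))
      rw [hτ2 s hs, mul_one, sub_self] at h1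
      exact h1
    have := hT.is_const_of_deriv_eq_zero hT'
      (fun s hs => (hd s hs).differentiableAt.differentiableWithinAt) (fun s hs => (hd s hs).deriv)
      ht' ht
    simp only at this ⊢
    linarith

end

/-! ### Jets and equations when the variables are transformed separately -/

theorem differentiableAt_deriv {F : ℝ → ℝ} {s : ℝ} (hF : ContDiffAt ℝ 2 F s) :
    DifferentiableAt ℝ (deriv F) s :=
  (differentiableAt_fderiv hF).clm_apply (differentiableAt_const 1)

theorem deriv_deriv_comp {F G : ℝ → ℝ} {s : ℝ} (hF : ContDiffAt ℝ 2 F (G s))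
    (hG : ContDiffAt ℝ 2 G s) :
    deriv (fun s => F (G s)) s = deriv F (G s) * deriv G s ∧
      deriv (deriv fun s => F (G s)) s =
        deriv (deriv F) (G s) * deriv G s ^ 2 + deriv F (G s) * deriv (deriv G) s := by
  have h1 : deriv (fun s => F (G s)) =ᶠ[𝓝 s] fun s => deriv F (G s) * deriv G s := by
    filter_upwards [eventually_differentiableAt hG,
      hG.continuousAt.eventually (eventually_differentiableAt hF)] with q h1 h2
    exact (h2.hasDerivAt.comp q h1.hasDerivAt).deriv
  refine ⟨h1.self_of_nhds, ?_⟩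
  have h2 := ((differentiableAt_deriv hF).hasDerivAt.comp s
    (hG.differentiableAt (by norm_num)).hasDerivAt).mul (differentiableAt_deriv hG).hasDerivAt
  rw [h1.deriv_eq]
  refine h2.deriv.trans ?_
  simp only [Function.comp]
  ring

section

variable {T I J : Set ℝ} {Φ : ℝ × ℝ × ℝ → ℝ × ℝ × ℝ} {δ₁ δ₂ : ℝ} {ξ μ : ℝ → ℝ}
  {u v : ℝ × ℝ → ℝ} {p : ℝ × ℝ}

theorem newBase_eventuallyEq (hB : IsOpen (box T I J))
    (hform : ∀ z ∈ box T I J, Φ z = (δ₁ * z.1 + δ₂, ξ z.2.1, μ z.2.2))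
    (hp : (p.1, p.2, u p) ∈ box T I J) (hu : ContinuousAt u p) :
    ∀ᶠ q in 𝓝 p, newBase Φ u q = (δ₁ * q.1 + δ₂, ξ q.2) ∧
      (Φ (q.1, q.2, u q)).2.2 = μ (u q) := by
  have hc : ContinuousAt (fun q : ℝ × ℝ => (q.1, q.2, u q)) p :=
    continuousAt_fst.prodMk (continuousAt_snd.prodMk hu)
  filter_upwards [hc.preimage_mem_nhds (hB.mem_nhds hp)] with q hq
  have := hform _ hq
  simp only at this
  exact ⟨by simp only [newBase, this], by rw [this]⟩

theorem det_newBase (hB : IsOpen (box T I J))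
    (hform : ∀ z ∈ box T I J, Φ z = (δ₁ * z.1 + δ₂, ξ z.2.1, μ z.2.2))
    (hp : (p.1, p.2, u p) ∈ box T I J) (hu : ContinuousAt u p)
    (hξ : DifferentiableAt ℝ ξ p.2) :
    (fderiv ℝ (newBase Φ u) p).det = δ₁ * deriv ξ p.2 := by
  have h1 : newBase Φ u =ᶠ[𝓝 p] fun q => (δ₁ * q.1 + δ₂, ξ q.2) :=
    (newBase_eventuallyEq hB hform hp hu).mono fun q h => h.1
  have h3 : HasFDerivAt (fun q : ℝ × ℝ => q.2) (ContinuousLinearMap.snd ℝ ℝ ℝ) p := hasFDerivAt_snd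
  have h2 : HasFDerivAt (fun q : ℝ × ℝ => (δ₁ * q.1 + δ₂, ξ q.2)) _ p :=
    ((hasFDerivAt_fst.const_mul δ₁).add_const δ₂).prodMk
      (hξ.hasDerivAt.comp_hasFDerivAt p h3)
  rw [h1.fderiv_eq, h2.fderiv, det_prod]
  simp

/-- The transformation of 2-jets if the variables are transformed separately. -/
theorem special_jet (hB : IsOpen (box T I J))
    (hform : ∀ z ∈ box T I J, Φ z = (δ₁ * z.1 + δ₂, ξ z.2.1, μ z.2.2))
    (hp : (p.1, p.2, u p) ∈ box T I J) (hu : ContDiffAt ℝ 2 u p)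
    (hξ : ContDiffAt ℝ 2 ξ p.2) (hμ : ContDiffAt ℝ 2 μ (u p))
    (hv : ContDiffAt ℝ 2 v (newBase Φ u p))
    (h : ∀ᶠ q in 𝓝 p, v (newBase Φ u q) = (Φ (q.1, q.2, u q)).2.2) :
    newBase Φ u p = (δ₁ * p.1 + δ₂, ξ p.2) ∧ v (newBase Φ u p) = μ (u p) ∧
    fderiv ℝ v (newBase Φ u p) (0, 1) * deriv ξ p.2 = deriv μ (u p) * fderiv ℝ u p (0, 1) ∧
    fderiv ℝ (fderiv ℝ v) (newBase Φ u p) (1, 0) (1, 0) * δ₁ ^ 2 =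
      deriv (deriv μ) (u p) * fderiv ℝ u p (1, 0) ^ 2 +
        deriv μ (u p) * fderiv ℝ (fderiv ℝ u) p (1, 0) (1, 0) ∧
    fderiv ℝ (fderiv ℝ v) (newBase Φ u p) (0, 1) (0, 1) * deriv ξ p.2 ^ 2 +
        fderiv ℝ v (newBase Φ u p) (0, 1) * deriv (deriv ξ) p.2 =
      deriv (deriv μ) (u p) * fderiv ℝ u p (0, 1) ^ 2 +
        deriv μ (u p) * fderiv ℝ (fderiv ℝ u) p (0, 1) (0, 1) := by
  have hnb := newBase_eventuallyEq hB hform hp hu.continuousAt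
  have h0 := hnb.self_of_nhds.1
  have hvu : ∀ᶠ q in 𝓝 p, v (δ₁ * q.1 + δ₂, ξ q.2) = μ (u q) := by
    filter_upwards [h, hnb] with q h1 h2
    rw [← h2.1, h1, h2.2]
  rw [h0] at hv ⊢
  obtain ⟨t, x⟩ := p
  simp only at hξ hv hvu ⊢
  have cl : ∀ t x : ℝ, ContDiff ℝ 2 fun t : ℝ => (t, x) := fun t x => by fun_prop
  have cr : ∀ t x : ℝ, ContDiff ℝ 2 fun x : ℝ => (t, x) := fun t x => by fun_prop
  have hd : ∀ {u : ℝ × ℝ → ℝ} {ι : ℝ → ℝ × ℝ} {s₀ : ℝ} {a : ℝ × ℝ} (_ : ∀ s, HasDerivAt ι a s)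
      (_ : ContDiffAt ℝ 2 u (ι s₀)), deriv (fun s => u (ι s)) s₀ = fderiv ℝ u (ι s₀) a ∧
        deriv (deriv fun s => u (ι s)) s₀ = fderiv ℝ (fderiv ℝ u) (ι s₀) a a :=
    fun hι hu => ⟨(deriv_comp_line hι hu).1.self_of_nhds, (deriv_comp_line hι hu).2.deriv⟩
  -- the direction of `t`
  have t1 := hd (s₀ := t) (hasDerivAt_mk_left x) hu
  have t2 := hd (s₀ := δ₁ * t + δ₂) (hasDerivAt_mk_left (ξ x)) hv
  have hlin : ContDiff ℝ 2 fun s : ℝ => δ₁ * s + δ₂ := by fun_prop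
  have t3 := deriv_deriv_comp (F := fun y => v (y, ξ x)) (G := fun s => δ₁ * s + δ₂) (s := t)
    (ContDiffAt.comp (δ₁ * t + δ₂) hv (cl 0 _).contDiffAt) hlin.contDiffAt
  have t4 := deriv_deriv_comp (F := μ) (G := fun s => u (s, x)) (s := t) hμ
    (ContDiffAt.comp t hu (cl 0 _).contDiffAt)
  have te : (fun s => v (δ₁ * s + δ₂, ξ x)) =ᶠ[𝓝 t] fun s => μ (u (s, x)) :=
    ((cl 0 x).continuous.tendsto t).eventually hvu
  have hld : deriv (fun s : ℝ => δ₁ * s + δ₂) = fun _ => δ₁ := by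
    funext s
    simp
  rw [hld, deriv_const, mul_zero, add_zero, te.deriv.deriv_eq, t4.2, t1.1, t1.2, t2.2] at t3
  -- the direction of `x`
  have x1 := hd (s₀ := x) (hasDerivAt_mk_right t) hu
  have x2 := hd (s₀ := ξ x) (hasDerivAt_mk_right (δ₁ * t + δ₂)) hv
  have x3 := deriv_deriv_comp (F := fun y => v (δ₁ * t + δ₂, y)) (G := ξ) (s := x)
    (ContDiffAt.comp (ξ x) hv (cr _ 0).contDiffAt) hξ
  have x4 := deriv_deriv_comp (F := μ) (G := fun s => u (t, s)) (s := x) hμ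
    (ContDiffAt.comp x hu (cr _ 0).contDiffAt)
  have xe : (fun s => v (δ₁ * t + δ₂, ξ s)) =ᶠ[𝓝 x] fun s => μ (u (t, s)) :=
    ((cr t 0).continuous.tendsto x).eventually hvu
  rw [xe.deriv_eq, xe.deriv.deriv_eq, x4.1, x4.2, x1.1, x1.2, x2.1, x2.2] at x3
  exact ⟨trivial, hvu.self_of_nhds, x3.1.symm, t3.2.symm, x3.2.symm⟩

end

section

variable {T I J : Set ℝ} {Φ : ℝ × ℝ × ℝ → ℝ × ℝ × ℝ} {δ₁ δ₂ : ℝ} {ξ μ : ℝ → ℝ}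

/-- The transformed equation in terms of the old 2-jet if the variables are transformed
separately. -/
theorem special_holdsAt {u v : ℝ × ℝ → ℝ} {p : ℝ × ℝ} {θ' : Elements} (hB : IsOpen (box T I J))
    (hform : ∀ z ∈ box T I J, Φ z = (δ₁ * z.1 + δ₂, ξ z.2.1, μ z.2.2))
    (hp : (p.1, p.2, u p) ∈ box T I J) (hu : ContDiffAt ℝ 2 u p)
    (hξ : ContDiffAt ℝ 2 ξ p.2) (hμ : ContDiffAt ℝ 2 μ (u p))
    (hv : ContDiffAt ℝ 2 v (newBase Φ u p))
    (h : ∀ᶠ q in 𝓝 p, v (newBase Φ u q) = (Φ (q.1, q.2, u q)).2.2) (hδ : δ₁ ≠ 0)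
    (hξ0 : deriv ξ p.2 ≠ 0) (hg : DifferentiableAt ℝ θ'.g (ξ p.2))
    (hH : DifferentiableAt ℝ θ'.H (μ (u p))) :
    HoldsAt θ' v (newBase Φ u p) ↔
      θ'.f (ξ p.2) * ((deriv (deriv μ) (u p) * fderiv ℝ u p (1, 0) ^ 2 +
        deriv μ (u p) * fderiv ℝ (fderiv ℝ u) p (1, 0) (1, 0)) / δ₁ ^ 2) =
      (deriv θ'.g (ξ p.2) * θ'.H (μ (u p)) + θ'.h (ξ p.2) * θ'.K (μ (u p))) *
        (deriv μ (u p) * fderiv ℝ u p (0, 1) / deriv ξ p.2) +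
      θ'.g (ξ p.2) * deriv θ'.H (μ (u p)) *
        (deriv μ (u p) * fderiv ℝ u p (0, 1) / deriv ξ p.2) ^ 2 +
      θ'.g (ξ p.2) * θ'.H (μ (u p)) *
        ((deriv (deriv μ) (u p) * fderiv ℝ u p (0, 1) ^ 2 +
          deriv μ (u p) * fderiv ℝ (fderiv ℝ u) p (0, 1) (0, 1) -
          deriv μ (u p) * fderiv ℝ u p (0, 1) / deriv ξ p.2 * deriv (deriv ξ) p.2) /
            deriv ξ p.2 ^ 2) := by
  obtain ⟨e0, e1, e2, e3, e4⟩ := special_jet hB hform hp hu hξ hμ hv h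
  have f2 := eq_div_of_mul_eq hξ0 e2
  have f3 := eq_div_of_mul_eq (pow_ne_zero 2 hδ) e3
  have f4 := eq_div_of_mul_eq (pow_ne_zero 2 hξ0) (eq_sub_of_add_eq e4)
  rw [holdsAt_iff hv (by rw [e0]; exact hg) (by rw [e1]; exact hH), e1, f4, f3, f2, e0]

/-- The equivalence of the equations as conditions on arbitrary 2-jets. -/
theorem special_transforms {θ θ' : Elements} (hB : IsOpen (box T I J)) (hI : IsOpen I)
    (hJ : IsOpen J) (hΦ : IsPointTransformation T I J Φ)
    (hform : ∀ z ∈ box T I J, Φ z = (δ₁ * z.1 + δ₂, ξ z.2.1, μ z.2.2)) (hδ : δ₁ ≠ 0)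
    (hξ : ContDiffOn ℝ ∞ ξ I) (hξ0 : ∀ x ∈ I, deriv ξ x ≠ 0) (hμ : ContDiffOn ℝ ∞ μ J)
    (hθ : θ ∈ classOn I J) (hθ' : θ' ∈ classOn (xImage T I J Φ) (uImage T I J Φ))
    (h : TransformsEquation T I J Φ θ θ') {t x w : ℝ} (hz : (t, x, w) ∈ box T I J)
    (a b r q : ℝ) :
    θ.f x * r = (deriv θ.g x * θ.H w + θ.h x * θ.K w) * b + θ.g x * deriv θ.H w * b ^ 2 +
        θ.g x * θ.H w * q ↔
      θ'.f (ξ x) * ((deriv (deriv μ) w * a ^ 2 + deriv μ w * r) / δ₁ ^ 2) =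
      (deriv θ'.g (ξ x) * θ'.H (μ w) + θ'.h (ξ x) * θ'.K (μ w)) * (deriv μ w * b / deriv ξ x) +
      θ'.g (ξ x) * deriv θ'.H (μ w) * (deriv μ w * b / deriv ξ x) ^ 2 +
      θ'.g (ξ x) * θ'.H (μ w) * ((deriv (deriv μ) w * b ^ 2 + deriv μ w * q -
        deriv μ w * b / deriv ξ x * deriv (deriv ξ) x) / deriv ξ x ^ 2) := by
  have hxI : x ∈ I := hz.2.1
  have hwJ : w ∈ J := hz.2.2
  set L : ℝ × ℝ →L[ℝ] ℝ := a • ContinuousLinearMap.fst ℝ ℝ ℝ + b • ContinuousLinearMap.snd ℝ ℝ ℝ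
    with hL
  set B : ℝ × ℝ →L[ℝ] ℝ × ℝ →L[ℝ] ℝ :=
    (ContinuousLinearMap.fst ℝ ℝ ℝ).smulRight (r • ContinuousLinearMap.fst ℝ ℝ ℝ) +
      (ContinuousLinearMap.snd ℝ ℝ ℝ).smulRight (q • ContinuousLinearMap.snd ℝ ℝ ℝ) with hBdef
  have hBsymm : ∀ c d, B c d = B d c := by
    intro c d
    simp [hBdef]
    ring
  set u := quadratic (t, x) w L B with hu_def
  have hu0 : u (t, x) = w := quadratic_self _ _ _ _
  have hu1 : fderiv ℝ u (t, x) = L := fderiv_quadratic_self _ _ _ _ hBsymm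
  have hu2 : fderiv ℝ (fderiv ℝ u) (t, x) = B := fderiv_fderiv_quadratic _ _ _ _ hBsymm
  have hu : ContDiffAt ℝ 2 u (t, x) := (contDiff_quadratic _ _ _ _).contDiffAt
  have hp : ((t, x).1, (t, x).2, u (t, x)) ∈ box T I J := by rw [hu0]; exact hz
  have hΦu : ContDiffAt ℝ 2 Φ ((t, x).1, (t, x).2, u (t, x)) :=
    (hΦ.contDiffAt hB hp).of_le two_le_infty
  have hξx : ContDiffAt ℝ 2 ξ x := (hξ.contDiffAt (hI.mem_nhds hxI)).of_le two_le_infty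
  have hμw : ContDiffAt ℝ 2 μ w := (hμ.contDiffAt (hJ.mem_nhds hwJ)).of_le two_le_infty
  have hdet : (fderiv ℝ (newBase Φ u) (t, x)).det ≠ 0 := by
    rw [det_newBase hB hform hp hu.continuousAt (hξx.differentiableAt (by norm_num))]
    exact mul_ne_zero hδ (hξ0 x hxI)
  have hW : ContDiffAt ℝ 2 (fun q : ℝ × ℝ => (Φ (q.1, q.2, u q)).2.2) (t, x) :=
    fiberProj.contDiff.contDiffAt.comp (t, x) (ContDiffAt.comp (t, x) hΦu (contDiffAt_graph hu))
  obtain ⟨v, hv, hvτ⟩ := exists_comp_eq (contDiffAt_newBase hΦu hu) hW hdet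
  have hiff := h u v (t, x) hz.1 hxI (by rw [hu0]; exact hwJ) hu hdet hv hvτ
  have hx' := hΦ.xImage_mem_nhds hB hz
  have hw' := hΦ.uImage_mem_nhds hB hz
  rw [hform _ hz] at hx' hw'
  have hgd : DifferentiableAt ℝ θ.g x :=
    (hθ.2.1.contDiffAt (hI.mem_nhds hxI)).differentiableAt (by simp)
  have hHd : DifferentiableAt ℝ θ.H w :=
    (hθ.2.2.2.1.contDiffAt (hJ.mem_nhds hwJ)).differentiableAt (by simp)
  have hgd' : DifferentiableAt ℝ θ'.g (ξ x) := (hθ'.2.1.contDiffAt hx').differentiableAt (by simp)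
  have hHd' : DifferentiableAt ℝ θ'.H (μ w) :=
    (hθ'.2.2.2.1.contDiffAt hw').differentiableAt (by simp)
  rw [holdsAt_iff hu hgd (by rw [hu0]; exact hHd),
    special_holdsAt hB hform hp hu hξx (by rw [hu0]; exact hμw) hv hvτ hδ (hξ0 x hxI) hgd'
      (by rw [hu0]; exact hHd'), hu1, hu2, hu0] at hiff
  simpa [hL, hBdef] using hiff

end

/-- The comparison of the coefficients of the two equations. -/
theorem coefficients_of_equiv {f P N M F P' N' M' μ₁ μ₂ ξ₁ ξ₂ δ : ℝ} (hf : f ≠ 0) (hF : F ≠ 0)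
    (hμ : μ₁ ≠ 0) (hδ : δ ≠ 0) (hξ : ξ₁ ≠ 0)
    (h : ∀ a b r q : ℝ, f * r = P * b + N * b ^ 2 + M * q →
      F * ((μ₂ * a ^ 2 + μ₁ * r) / δ ^ 2) = P' * (μ₁ * b / ξ₁) + N' * (μ₁ * b / ξ₁) ^ 2 +
        M' * ((μ₂ * b ^ 2 + μ₁ * q - μ₁ * b / ξ₁ * ξ₂) / ξ₁ ^ 2)) :
    μ₂ = 0 ∧ F * M * ξ₁ ^ 2 = f * M' * δ ^ 2 ∧
      F * P * ξ₁ ^ 2 = f * δ ^ 2 * (P' * ξ₁ - M' * ξ₂ / ξ₁) := by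
  -- The test jets: `a = 1` isolates the term `u_t ^ 2`; `q = 1` isolates `u_xx`; and half the
  -- difference of `b = 1` and `b = -1` isolates the terms linear in `u_x`. In each case `r` is
  -- chosen so that the old equation holds.
  have h1 := h 1 0 0 0 (by ring)
  have h2 := h 0 0 (M / f) 1 (by field_simp; ring)
  have h3 := h 0 1 ((P + N) / f) 0 (by field_simp; ring)
  have h4 := h 0 (-1) ((-P + N) / f) 0 (by field_simp; ring)
  refine ⟨?_, ?_, ?_⟩
  · have h5 : F * (μ₂ / δ ^ 2) = 0 := by linear_combination h1
    simpa [hF, hδ] using h5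
  · have h5 : F * (μ₁ * (M / f) / δ ^ 2) = M' * (μ₁ / ξ₁ ^ 2) := by linear_combination h2
    field_simp at h5
    linear_combination h5
  · have h6 : F * (μ₁ * (P / f) / δ ^ 2) = P' * (μ₁ / ξ₁) - M' * (μ₁ / ξ₁ * ξ₂ / ξ₁ ^ 2) := by
      linear_combination (h3 - h4) / 2
    field_simp at h6 ⊢
    linear_combination h6

/-! ### Affinity in `u`, and the relations between old and new arbitrary elements -/

section

variable {T I J : Set ℝ} {Φ : ℝ × ℝ × ℝ → ℝ × ℝ × ℝ} {Θ : Elements → Elements}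

/-- The transformation of the variables has the stated form. -/
theorem exists_varParams (hT : IsOpen T) (hT' : IsPreconnected T) (hI : IsOpen I)
    (hI' : IsPreconnected I) (hJ : IsOpen J) (hJ' : IsPreconnected J) (hne : (box T I J).Nonempty)
    (hE : IsExtendedEquivalence T I J (genericOn I J) Φ Θ) :
    ∃ d : VarParams, d.Admissible I ∧ EqOn Φ d.map (box T I J) := by
  obtain ⟨δ₁, δ₂, ξ, μ, hδ, hξ, hξ0, hμ, hμ0, hform⟩ :=
    exists_variable_form hT hT' hI hI' hJ hJ' hne hE
  have hB := isOpen_box hT hI hJ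
  obtain ⟨⟨t, x, u⟩, ht, hx, hu⟩ := hne
  have hg := generic_id_of_contDiff hJ ⟨x, hx⟩ ⟨u, hu⟩ (F := fun _ => 1) contDiff_const
    (fun _ => one_ne_zero)
  obtain ⟨hc, htr⟩ := hE.2 _ hg
  have h2 : ∀ w ∈ J, deriv (deriv μ) w = 0 := by
    intro w hw
    have hz : (t, x, w) ∈ box T I J := ⟨ht, hx, hw⟩
    have h := special_transforms hB hI hJ hE.1 hform hδ hξ hξ0 hμ hg.1 hc htr hz
    have hxm : ξ x ∈ xImage T I J Φ := ⟨_, hz, by simp only [hform _ hz]⟩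
    exact (coefficients_of_equiv (hg.1.2.2.2.2.2.1 x hx) (hc.2.2.2.2.2.1 _ hxm) (hμ0 w hw) hδ
      (hξ0 x hx) fun a b r q => (h a b r q).1).1
  have hμd : ∀ w ∈ J, ContDiffAt ℝ 2 μ w := fun w hw =>
    (hμ.contDiffAt (hJ.mem_nhds hw)).of_le two_le_infty
  have h1 : ∀ w ∈ J, deriv μ w = deriv μ u := fun w hw =>
    hJ.is_const_of_deriv_eq_zero hJ'
      (fun s hs => (differentiableAt_deriv (hμd s hs)).differentiableWithinAt) h2 hw hu
  have h0 : ∀ w ∈ J, μ w = deriv μ u * w + (μ u - deriv μ u * u) := by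
    intro w hw
    have hd : ∀ s ∈ J, HasDerivAt (fun s => μ s - deriv μ u * s) 0 s := by
      intro s hs
      have h1' := ((hμd s hs).differentiableAt (by norm_num)).hasDerivAt.sub
        ((hasDerivAt_id s).const_mul (deriv μ u))
      rw [h1 s hs, mul_one, sub_self] at h1'
      exact h1'
    have := hJ.is_const_of_deriv_eq_zero hJ'
      (fun s hs => (hd s hs).differentiableAt.differentiableWithinAt) (fun s hs => (hd s hs).deriv)
      hw hu
    simp only at this
    linarith
  refine ⟨⟨δ₁, δ₂, deriv μ u, μ u - deriv μ u * u, ξ⟩, ⟨mul_ne_zero hδ (hμ0 u hu), hξ, hξ0⟩, ?_⟩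
  intro z hz
  rw [hform z hz, h0 _ hz.2.2]
  rfl

theorem deriv_affine (a b : ℝ) : deriv (fun u : ℝ => a * u + b) = fun _ => a := by
  funext s
  simp

theorem deriv_deriv_affine (a b w : ℝ) : deriv (deriv fun u : ℝ => a * u + b) w = 0 := by
  rw [deriv_affine, deriv_const]

/-- The relations between the arbitrary elements of two equations that are transformed to each
other. -/
structure ElementsRelated (I J : Set ℝ) (d : VarParams) (ε₂ : ℝ) (E : ℝ → ℝ) (θ θ' : Elements) :
    Prop where
  ne_zero : ε₂ ≠ 0
  factor_ne_zero : ∀ x ∈ I, E x ≠ 0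
  differentiableAt : ∀ x ∈ I, DifferentiableAt ℝ E x
  f_eq : ∀ x ∈ I, θ'.f (d.X x) = E x * d.δ₁ ^ 2 / deriv d.X x * θ.f x
  g_eq : ∀ x ∈ I, θ'.g (d.X x) = ε₂⁻¹ * E x * deriv d.X x * θ.g x
  H_eq : ∀ u ∈ J, θ'.H (d.δ₃ * u + d.δ₄) = ε₂ * θ.H u
  hK_eq : ∀ x ∈ I, ∀ u ∈ J, E x * θ.h x * θ.K u - deriv E x * θ.g x * θ.H u =
    θ'.h (d.X x) * θ'.K (d.δ₃ * u + d.δ₄)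

/-- The coefficient of `u_xx` relative to that of `u_tt` separates `x` from `u` and gives the
formulas for `H`, `g` and `f`; the coefficient of `u_x` gives the bilinear identity. No genericity
is needed, so this also serves the degenerate tuples. -/
theorem exists_elementsRelated {θ θ' : Elements} {d : VarParams} (hT : IsOpen T) (hI : IsOpen I)
    (hJ : IsOpen J) (hne : (box T I J).Nonempty) (hΦ : IsPointTransformation T I J Φ)
    (hd : d.Admissible I) (hform : EqOn Φ d.map (box T I J))
    (hθ : θ ∈ classOn I J) (hθ' : θ' ∈ classOn (xImage T I J Φ) (uImage T I J Φ))
    (h : TransformsEquation T I J Φ θ θ') :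
    ∃ (ε₂ : ℝ) (E : ℝ → ℝ), ElementsRelated I J d ε₂ E θ θ' := by
  have hB := isOpen_box hT hI hJ
  obtain ⟨hδ, hX, hX0⟩ := hd
  have hδ₁ : d.δ₁ ≠ 0 := left_ne_zero_of_mul hδ
  have hδ₃ : d.δ₃ ≠ 0 := right_ne_zero_of_mul hδ
  obtain ⟨⟨t, x₀, u₀⟩, ht, hx₀, hu₀⟩ := hne
  have xm : ∀ x ∈ I, xImage T I J Φ ∈ 𝓝 (d.X x) := by
    intro x hx
    have hz : (t, x, u₀) ∈ box T I J := ⟨ht, hx, hu₀⟩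
    have := hΦ.xImage_mem_nhds hB hz
    rwa [hform hz] at this
  have um : ∀ u ∈ J, uImage T I J Φ ∈ 𝓝 (d.δ₃ * u + d.δ₄) := by
    intro u hu
    have hz : (t, x₀, u) ∈ box T I J := ⟨ht, hx₀, hu⟩
    have := hΦ.uImage_mem_nhds hB hz
    rwa [hform hz] at this
  have f0 := fun x hx => hθ.2.2.2.2.2.1 x hx
  have g0 := fun x hx => hθ.2.2.2.2.2.2.1 x hx
  have H0 := fun u hu => hθ.2.2.2.2.2.2.2.1 u hu
  have f0' := fun x hx => hθ'.2.2.2.2.2.1 _ (mem_of_mem_nhds (xm x hx))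
  have g0' := fun x hx => hθ'.2.2.2.2.2.2.1 _ (mem_of_mem_nhds (xm x hx))
  have H0' := fun u hu => hθ'.2.2.2.2.2.2.2.1 _ (mem_of_mem_nhds (um u hu))
  have rel : ∀ x ∈ I, ∀ u ∈ J,
      θ'.f (d.X x) * (θ.g x * θ.H u) * deriv d.X x ^ 2 =
        θ.f x * (θ'.g (d.X x) * θ'.H (d.δ₃ * u + d.δ₄)) * d.δ₁ ^ 2 ∧
      θ'.f (d.X x) * (deriv θ.g x * θ.H u + θ.h x * θ.K u) * deriv d.X x ^ 2 =
        θ.f x * d.δ₁ ^ 2 * ((deriv θ'.g (d.X x) * θ'.H (d.δ₃ * u + d.δ₄) +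
          θ'.h (d.X x) * θ'.K (d.δ₃ * u + d.δ₄)) * deriv d.X x -
          θ'.g (d.X x) * θ'.H (d.δ₃ * u + d.δ₄) * deriv (deriv d.X) x / deriv d.X x) := by
    intro x hx u hu
    have hμ : ContDiffOn ℝ ∞ (fun u => d.δ₃ * u + d.δ₄) J := by fun_prop
    have h1 := special_transforms hB hI hJ hΦ (μ := fun u => d.δ₃ * u + d.δ₄) (fun z hz => hform hz)
      hδ₁ hX hX0 hμ hθ hθ' h (t := t) (x := x) (w := u) ⟨ht, hx, hu⟩
    refine (coefficients_of_equiv (f0 x hx) (f0' x hx) ?_ hδ₁ (hX0 x hx)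
      fun a b r q => (h1 a b r q).1).2
    rw [deriv_affine]
    exact hδ₃
  set ε₂ : ℝ := θ'.H (d.δ₃ * u₀ + d.δ₄) / θ.H u₀ with hε₂
  have hε0 : ε₂ ≠ 0 := div_ne_zero (H0' u₀ hu₀) (H0 u₀ hu₀)
  have hH : ∀ u ∈ J, θ'.H (d.δ₃ * u + d.δ₄) = ε₂ * θ.H u := by
    intro u hu
    have r1 := (rel x₀ hx₀ u hu).1
    have r2 := (rel x₀ hx₀ u₀ hu₀).1
    have hk : θ.f x₀ * θ'.g (d.X x₀) * d.δ₁ ^ 2 ≠ 0 :=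
      mul_ne_zero (mul_ne_zero (f0 _ hx₀) (g0' _ hx₀)) (pow_ne_zero 2 hδ₁)
    have e : θ'.H (d.δ₃ * u + d.δ₄) * θ.H u₀ = θ'.H (d.δ₃ * u₀ + d.δ₄) * θ.H u :=
      mul_left_cancel₀ hk (by linear_combination θ.H u * r2 - θ.H u₀ * r1)
    rw [hε₂]
    have := H0 u₀ hu₀
    field_simp
    exact e
  -- `E` is defined by the desired formula for `g`; the formula for `f` then follows from the
  -- principal part. It will turn out to be `ε₁ * exp (-ε₄ * P)`.
  set E : ℝ → ℝ := fun x => ε₂ * θ'.g (d.X x) / (deriv d.X x * θ.g x) with hEdef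
  have hg : ∀ x ∈ I, θ'.g (d.X x) = ε₂⁻¹ * E x * deriv d.X x * θ.g x := by
    intro x hx
    have h1 := hX0 x hx
    have h2 := g0 x hx
    rw [hEdef]
    field_simp
  have hf : ∀ x ∈ I, θ'.f (d.X x) = E x * d.δ₁ ^ 2 / deriv d.X x * θ.f x := by
    intro x hx
    have h1 := hX0 x hx
    have h2 := g0 x hx
    have r1 := (rel x hx u₀ hu₀).1
    rw [hH u₀ hu₀, hg x hx] at r1
    have hk : θ.g x * θ.H u₀ * deriv d.X x ≠ 0 := mul_ne_zero (mul_ne_zero h2 (H0 _ hu₀)) h1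
    refine mul_right_cancel₀ hk ?_
    field_simp at r1 ⊢
    linear_combination r1
  have hXd : ∀ x ∈ I, ContDiffAt ℝ 2 d.X x := fun x hx =>
    (hX.contDiffAt (hI.mem_nhds hx)).of_le two_le_infty
  have hgd : ∀ x ∈ I, HasDerivAt θ.g (deriv θ.g x) x := fun x hx =>
    ((hθ.2.1.contDiffAt (hI.mem_nhds hx)).differentiableAt (by simp)).hasDerivAt
  have hgd' : ∀ x ∈ I, HasDerivAt (fun x => θ'.g (d.X x)) (deriv θ'.g (d.X x) * deriv d.X x) x :=
    fun x hx => ((hθ'.2.1.contDiffAt (xm x hx)).differentiableAt (by simp)).hasDerivAt.comp x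
      ((hXd x hx).differentiableAt (by norm_num)).hasDerivAt
  have hEd : ∀ x ∈ I, HasDerivAt E (deriv E x) x := by
    intro x hx
    have := ((hgd' x hx).const_mul ε₂).div
      ((differentiableAt_deriv (hXd x hx)).hasDerivAt.mul (hgd x hx))
      (mul_ne_zero (hX0 x hx) (g0 x hx))
    exact this.differentiableAt.hasDerivAt
  refine ⟨ε₂, E, hε0, fun x hx => ?_, fun x hx => (hEd x hx).differentiableAt, hf, hg, hH,
    fun x hx u hu => ?_⟩
  · exact div_ne_zero (mul_ne_zero hε0 (g0' x hx)) (mul_ne_zero (hX0 x hx) (g0 x hx))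
  · have r := (rel x hx u hu).2
    -- The formula for `g` is differentiated to remove the derivative of the new `g`. On
    -- substitution the terms with `deriv (deriv d.X)` and with `deriv θ.g` cancel, and only `deriv
    -- E` survives.
    have e : deriv θ'.g (d.X x) * deriv d.X x = (ε₂⁻¹ * deriv E x * deriv d.X x +
        ε₂⁻¹ * E x * deriv (deriv d.X) x) * θ.g x + ε₂⁻¹ * E x * deriv d.X x * deriv θ.g x := by
      have h1 := (((hEd x hx).const_mul ε₂⁻¹).mul
        (differentiableAt_deriv (hXd x hx)).hasDerivAt).mul (hgd x hx)
      refine (hgd' x hx).unique (h1.congr_of_eventuallyEq ?_)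
      filter_upwards [hI.mem_nhds hx] with y hy using hg y hy
    rw [hf x hx, hg x hx, hH u hu] at r
    have h1 := hX0 x hx
    have h2 := f0 x hx
    have r' : θ.f x * d.δ₁ ^ 2 * deriv d.X x *
        (E x * (deriv θ.g x * θ.H u + θ.h x * θ.K u)) =
        θ.f x * d.δ₁ ^ 2 * ((deriv θ'.g (d.X x) * deriv d.X x) * (ε₂ * θ.H u) +
          θ'.h (d.X x) * θ'.K (d.δ₃ * u + d.δ₄) * deriv d.X x -
          E x * θ.g x * θ.H u * deriv (deriv d.X) x) := by
      field_simp at r ⊢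
      linear_combination r
    rw [e] at r'
    clear_value E
    field_simp at r'
    refine mul_left_cancel₀ h1 ?_
    linear_combination r'

end

/-! ### Antiderivatives and the linear equation for the factor `E` -/

section Antiderivative

variable {I : Set ℝ}

theorem hasDerivAt_integral (hI : IsOpen I) (hI' : IsPreconnected I) {φ : ℝ → ℝ}
    (hφ : ContinuousOn φ I) {x₀ x : ℝ} (hx₀ : x₀ ∈ I) (hx : x ∈ I) :
    HasDerivAt (fun x => ∫ y in x₀..x, φ y) (φ x) x := by
  have hsub : uIcc x₀ x ⊆ I := hI'.ordConnected.uIcc_subset hx₀ hx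
  exact intervalIntegral.integral_hasDerivAt_right (hφ.mono hsub).intervalIntegrable
    (hφ.stronglyMeasurableAtFilter hI x hx) (hφ.continuousAt (hI.mem_nhds hx))

/-- The solutions of a homogeneous linear equation. -/
theorem eq_exp_of_deriv (hI : IsOpen I) (hI' : IsPreconnected I) {E P k : ℝ → ℝ} {c x₀ : ℝ}
    (hx₀ : x₀ ∈ I) (hE0 : E x₀ ≠ 0) (hE : ∀ x ∈ I, DifferentiableAt ℝ E x)
    (hP : ∀ x ∈ I, HasDerivAt P (k x) x) (h : ∀ x ∈ I, deriv E x = -c * k x * E x) :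
    ∃ a : ℝ, a ≠ 0 ∧ ∀ x ∈ I, E x = a * Real.exp (-c * P x) := by
  have hd : ∀ x ∈ I, HasDerivAt (fun x => E x * Real.exp (c * P x)) 0 x := by
    intro x hx
    have h1 := (hE x hx).hasDerivAt.mul ((hP x hx).const_mul c).exp
    rw [h x hx] at h1
    refine h1.congr_deriv ?_
    ring
  refine ⟨E x₀ * Real.exp (c * P x₀), mul_ne_zero hE0 (Real.exp_ne_zero _), fun x hx => ?_⟩
  have h2 := hI.is_const_of_deriv_eq_zero hI'
    (fun s hs => (hd s hs).differentiableAt.differentiableWithinAt) (fun s hs => (hd s hs).deriv)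
    hx hx₀
  have h3 : c * P x + -c * P x = 0 := by ring
  rw [← h2, mul_assoc, ← Real.exp_add, h3, Real.exp_zero, mul_one]

end Antiderivative

/-! ### Determination of the constants -/

section

variable {T I J : Set ℝ} {Φ : ℝ × ℝ × ℝ → ℝ × ℝ × ℝ} {Θ : Elements → Elements}
  {d : VarParams} {θ θ' : Elements}

theorem continuousOn_ratio (hθ : θ ∈ classOn I J) : ContinuousOn (fun x => θ.h x / θ.g x) I :=
  hθ.2.2.1.continuousOn.div hθ.2.1.continuousOn hθ.2.2.2.2.2.2.1

/-- The hypothesis `hE'` is the linear equation `E' = -ε₄ (h / g) E`, whose nonzero solutions on an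
interval are `ε₁ * exp (-ε₄ * ∫ h / g)`. Here `ε₁` is the constant of integration. -/
theorem exists_elementsTransformed (hI : IsOpen I) (hI' : IsConnected I) (hθ : θ ∈ classOn I J)
    {ε₂ ε₃ ε₄ : ℝ} {E : ℝ → ℝ} (hE0 : ∀ x ∈ I, E x ≠ 0) (hE : ∀ x ∈ I, DifferentiableAt ℝ E x)
    (hE' : ∀ x ∈ I, deriv E x * θ.g x = -ε₄ * E x * θ.h x)
    (hf : ∀ x ∈ I, θ'.f (d.X x) = E x * d.δ₁ ^ 2 / deriv d.X x * θ.f x)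
    (hg : ∀ x ∈ I, θ'.g (d.X x) = ε₂⁻¹ * E x * deriv d.X x * θ.g x)
    (hh : ∀ x ∈ I, θ'.h (d.X x) = ε₃⁻¹ * E x * θ.h x)
    (hH : ∀ u ∈ J, θ'.H (d.δ₃ * u + d.δ₄) = ε₂ * θ.H u)
    (hK : ∀ u ∈ J, θ'.K (d.δ₃ * u + d.δ₄) = ε₃ * (θ.K u + ε₄ * θ.H u)) :
    ∃ ε₁ : ℝ, ε₁ ≠ 0 ∧ ElementsTransformed I J d ε₁ ε₂ ε₃ ε₄ θ θ' := by
  obtain ⟨x₀, hx₀⟩ := hI'.nonempty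
  have hP := fun x hx => hasDerivAt_integral hI hI'.isPreconnected (continuousOn_ratio hθ) hx₀
    (x := x) hx
  obtain ⟨ε₁, h1, h2⟩ := eq_exp_of_deriv hI hI'.isPreconnected (c := ε₄) hx₀ (hE0 x₀ hx₀) hE hP
    (fun x hx => by
      have := hθ.2.2.2.2.2.2.1 x hx
      field_simp
      linear_combination hE' x hx)
  refine ⟨ε₁, h1, _, hP, fun x hx => ?_, fun x hx => ?_, fun x hx => ?_, hH, hK⟩
  · rw [hf x hx, h2 x hx]; ring
  · rw [hg x hx, h2 x hx]; ring
  · rw [hh x hx, h2 x hx]; ring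

/-- At a point `x₀` with `h ≠ 0`, independence of `H` and `K` prevents the new `h` from vanishing,
so the bilinear identity can be solved there for the new `K`. Putting the result back at every `x`
and comparing the coefficients of `H` and `K` gives the new `h` and the linear equation for `E`. -/
theorem generic_elementsTransformed (hI : IsOpen I) (hI' : IsConnected I)
    (hθ : θ ∈ genericOn I J) {ε₂ : ℝ} {E : ℝ → ℝ} (h : ElementsRelated I J d ε₂ E θ θ') :
    ∃ ε₁ ε₂ ε₃ ε₄ : ℝ, ε₁ * ε₂ * ε₃ ≠ 0 ∧ ElementsTransformed I J d ε₁ ε₂ ε₃ ε₄ θ θ' := by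
  obtain ⟨hc, ⟨x₀, hx₀, hh₀⟩, hind⟩ := hθ
  have hEh : E x₀ * θ.h x₀ ≠ 0 := mul_ne_zero (h.factor_ne_zero x₀ hx₀) hh₀
  have hh' : θ'.h (d.X x₀) ≠ 0 := by
    intro h0
    refine hEh (hind (-(deriv E x₀ * θ.g x₀)) (E x₀ * θ.h x₀) fun u hu => ?_).2
    have := h.hK_eq x₀ hx₀ u hu
    rw [h0] at this
    linear_combination this
  set ε₃ : ℝ := E x₀ * θ.h x₀ / θ'.h (d.X x₀) with hε₃
  have hε0 : ε₃ ≠ 0 := div_ne_zero hEh hh'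
  set ε₄ : ℝ := -(deriv E x₀ * θ.g x₀) / (E x₀ * θ.h x₀) with hε₄
  have hK : ∀ u ∈ J, θ'.K (d.δ₃ * u + d.δ₄) = ε₃ * (θ.K u + ε₄ * θ.H u) := by
    intro u hu
    have := h.hK_eq x₀ hx₀ u hu
    have h1 := h.factor_ne_zero x₀ hx₀
    rw [hε₃, hε₄]
    field_simp
    linear_combination -this
  have hco : ∀ x ∈ I, -(deriv E x * θ.g x) - θ'.h (d.X x) * ε₃ * ε₄ = 0 ∧
      E x * θ.h x - θ'.h (d.X x) * ε₃ = 0 := fun x hx => hind _ _ fun u hu => by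
    have := h.hK_eq x hx u hu
    rw [hK u hu] at this
    linear_combination this
  obtain ⟨ε₁, h1, h2⟩ := exists_elementsTransformed (ε₂ := ε₂) (ε₃ := ε₃) (ε₄ := ε₄) hI hI' hc
    h.factor_ne_zero h.differentiableAt
    (fun x hx => by linear_combination -(hco x hx).1 + ε₄ * (hco x hx).2) h.f_eq h.g_eq
    (fun x hx => by field_simp; linear_combination -(hco x hx).2) h.H_eq hK
  exact ⟨ε₁, ε₂, ε₃, ε₄, mul_ne_zero (mul_ne_zero h1 h.ne_zero) hε0, h2⟩

/-- For separated rules, all tuples of arbitrary elements are transformed by the formulas, with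
common constants. -/
theorem separated_elementsTransformed (hT : IsOpen T) (hI : IsOpen I) (hI' : IsConnected I)
    (hJ : IsOpen J) (hne : (box T I J).Nonempty) (hd : d.Admissible I)
    (hform : EqOn Φ d.map (box T I J)) (hs : IsSeparated T I J Φ Θ)
    (hE : IsExtendedEquivalence T I J (classOn I J) Φ Θ) :
    ∃ ε₂ ε₃ ε₄ : ℝ, ε₂ * ε₃ ≠ 0 ∧ ∀ θ ∈ classOn I J, ∃ ε₁ : ℝ, ε₁ ≠ 0 ∧
      ElementsTransformed I J d ε₁ ε₂ ε₃ ε₄ θ (Θ θ) := by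
  have hrel := fun θ hθ =>
    exists_elementsRelated hT hI hJ hne hE.1 hd hform (θ := θ) hθ (hE.2 θ hθ).1 (hE.2 θ hθ).2
  obtain ⟨⟨t, x₀, u₀⟩, ht, hx₀, hu₀⟩ := hne
  have xm : ∀ x ∈ I, d.X x ∈ xImage T I J Φ := by
    intro x hx
    have hz : (t, x, u₀) ∈ box T I J := ⟨ht, hx, hu₀⟩
    exact ⟨_, hz, by simp only [hform hz]; rfl⟩
  have um : ∀ u ∈ J, d.δ₃ * u + d.δ₄ ∈ uImage T I J Φ := by
    intro u hu
    have hz : (t, x₀, u) ∈ box T I J := ⟨ht, hx₀, hu⟩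
    exact ⟨_, hz, by simp only [hform hz]; rfl⟩
  -- A fixed generic reference tuple; its constants `ε₂`, `ε₃`, `ε₄` will serve for the whole class.
  have hO : (⟨fun _ => 1, fun _ => 1, fun _ => 1, fun _ => 1, fun u => u⟩ : Elements) ∈
    genericOn I J := generic_id_of_contDiff hJ ⟨x₀, hx₀⟩ ⟨u₀, hu₀⟩ contDiff_const
      fun _ => one_ne_zero
  obtain ⟨e₂, EO, rO⟩ := hrel _ hO.1
  obtain ⟨ε₁, ε₂, ε₃, ε₄, hε, tO⟩ := generic_elementsTransformed hI hI' hO rO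
  have hε₁ : ε₁ ≠ 0 := left_ne_zero_of_mul (left_ne_zero_of_mul hε)
  have hε₂ : ε₂ ≠ 0 := right_ne_zero_of_mul (left_ne_zero_of_mul hε)
  have hε₃ : ε₃ ≠ 0 := right_ne_zero_of_mul hε
  obtain ⟨PO, hPO, fO, gO, hO', HO, KO⟩ := tO
  refine ⟨ε₂, ε₃, ε₄, mul_ne_zero hε₂ hε₃, fun θ hθ => ?_⟩
  obtain ⟨cf, cg, ch, cH, cK, f0, g0, H0, hnl⟩ := hθ
  -- The two mixed tuples: the `x`-part of `θ` with the `u`-part of the reference, and conversely.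
  -- They need not be generic, but for each of them separatedness already gives half of the new
  -- arbitrary elements.
  have hA : (⟨θ.f, θ.g, θ.h, fun _ => 1, fun u => u⟩ : Elements) ∈ classOn I J :=
    ⟨cf, cg, ch, contDiffOn_const, contDiffOn_id, f0, g0, fun _ _ => one_ne_zero, u₀, hu₀,
      Or.inr (by rw [deriv_id'']; exact one_ne_zero)⟩
  have hB : (⟨fun _ => 1, fun _ => 1, fun _ => 1, θ.H, θ.K⟩ : Elements) ∈ classOn I J :=
    ⟨contDiffOn_const, contDiffOn_const, contDiffOn_const, cH, cK, fun _ _ => one_ne_zero,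
      fun _ _ => one_ne_zero, H0, hnl⟩
  have hθ : θ ∈ classOn I J := ⟨cf, cg, ch, cH, cK, f0, g0, H0, hnl⟩
  obtain ⟨a₂, EA, rA⟩ := hrel _ hA
  obtain ⟨b₂, EB, rB⟩ := hrel _ hB
  obtain ⟨sf, sg, sh⟩ := (hs _ hθ _ hA).1 (fun _ _ => rfl) (fun _ _ => rfl) fun _ _ => rfl
  obtain ⟨sH, sK⟩ := (hs _ hθ _ hB).2 (fun _ _ => rfl) fun _ _ => rfl
  obtain ⟨sHA, sKA⟩ := (hs _ hA _ hO.1).2 (fun _ _ => rfl) fun _ _ => rfl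
  obtain ⟨sfB, sgB, shB⟩ := (hs _ hB _ hO.1).1 (fun _ _ => rfl) (fun _ _ => rfl) fun _ _ => rfl
  -- the functions of `x`
  have ha₂ : a₂ = ε₂ := by
    have h1 := rA.H_eq u₀ hu₀
    rw [sHA (um u₀ hu₀), HO u₀ hu₀] at h1
    simpa using h1.symm
  -- With the new `K` known from the reference, the bilinear identity is affine in `u`; two values
  -- of `u` separate its coefficients, even if `h` vanishes.
  have hcoA : ∀ x ∈ I, (Θ ⟨θ.f, θ.g, θ.h, fun _ => 1, fun u => u⟩).h (d.X x) =
      ε₃⁻¹ * EA x * θ.h x ∧ deriv EA x * θ.g x = -ε₄ * EA x * θ.h x := by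
    intro x hx
    have h1 : ∀ u ∈ J, EA x * θ.h x * u - deriv EA x * θ.g x =
        (Θ ⟨θ.f, θ.g, θ.h, fun _ => 1, fun u => u⟩).h (d.X x) * (ε₃ * (u + ε₄)) := by
      intro u hu
      have h2 := rA.hK_eq x hx u hu
      rw [sKA (um u hu), KO u hu] at h2
      simpa using h2
    obtain ⟨w, hw, hwu⟩ := exists_ne_mem hJ hu₀
    have h2 : EA x * θ.h x =
        (Θ ⟨θ.f, θ.g, θ.h, fun _ => 1, fun u => u⟩).h (d.X x) * ε₃ :=
      mul_right_cancel₀ (sub_ne_zero.2 hwu) (by linear_combination h1 w hw - h1 u₀ hu₀)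
    constructor
    · field_simp
      linear_combination -h2
    · linear_combination -h1 u₀ hu₀ + (u₀ + ε₄) * h2
  -- the functions of `u`
  have hEB : ∀ x ∈ I, EB x = ε₁ * Real.exp (-ε₄ * PO x) := by
    intro x hx
    have h1 := rB.f_eq x hx
    have hX := hd.2.2 x hx
    have hδ : d.δ₁ ≠ 0 := left_ne_zero_of_mul hd.1
    rw [sfB (xm x hx), fO x hx] at h1
    refine mul_right_cancel₀ (div_ne_zero (pow_ne_zero 2 hδ) hX) ?_
    linear_combination -h1
  have hb₂ : b₂ = ε₂ := by
    have h1 := rB.g_eq x₀ hx₀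
    have hX := hd.2.2 x₀ hx₀
    have hb := rB.ne_zero
    have hx := Real.exp_ne_zero (-ε₄ * PO x₀)
    rw [sgB (xm x₀ hx₀), gO x₀ hx₀, hEB x₀ hx₀] at h1
    have hk : ε₁ * Real.exp (-ε₄ * PO x₀) * deriv d.X x₀ ≠ 0 := mul_ne_zero (mul_ne_zero hε₁ hx) hX
    exact inv_injective (mul_right_cancel₀ hk (by linear_combination -h1))
  have hKB : ∀ u ∈ J, (Θ ⟨fun _ => 1, fun _ => 1, fun _ => 1, θ.H, θ.K⟩).K (d.δ₃ * u + d.δ₄) =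
      ε₃ * (θ.K u + ε₄ * θ.H u) := by
    intro u hu
    have h1 := rB.hK_eq x₀ hx₀ u hu
    have h2 : HasDerivAt EB (ε₁ * (Real.exp (-ε₄ * PO x₀) * (-ε₄ * (1 / 1)))) x₀ := by
      refine ((((hPO x₀ hx₀).const_mul (-ε₄)).exp).const_mul ε₁).congr_of_eventuallyEq ?_
      filter_upwards [hI.mem_nhds hx₀] with y hy using hEB y hy
    rw [shB (xm x₀ hx₀), hO' x₀ hx₀, h2.deriv, hEB x₀ hx₀] at h1
    have hx := Real.exp_ne_zero (-ε₄ * PO x₀)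
    refine mul_left_cancel₀ (mul_ne_zero hε₁ hx) ?_
    field_simp at h1 ⊢
    linear_combination -h1
  refine exists_elementsTransformed hI hI' hθ rA.factor_ne_zero rA.differentiableAt
    (fun x hx => (hcoA x hx).2) (fun x hx => ?_) (fun x hx => ?_) (fun x hx => ?_)
    (fun u hu => ?_) (fun u hu => ?_)
  · rw [sf (xm x hx)]; exact rA.f_eq x hx
  · rw [sg (xm x hx), ← ha₂]; exact rA.g_eq x hx
  · rw [sh (xm x hx)]; exact (hcoA x hx).1
  · rw [sH (um u hu), ← hb₂]; exact rB.H_eq u hu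
  · rw [sK (um u hu)]; exact hKB u hu

end

/-- If a composition with a local diffeomorphism of the line is smooth, so is the function. -/
theorem contDiffAt_of_comp {F X φ : ℝ → ℝ} {x : ℝ} (hX : ContDiffAt ℝ ∞ X x) (hX0 : deriv X x ≠ 0)
    (hφ : ContDiffAt ℝ ∞ φ x) (h : ∀ᶠ y in 𝓝 x, F (X y) = φ y) : ContDiffAt ℝ ∞ F (X x) := by
  have hd : HasFDerivAt X
      (ContinuousLinearEquiv.unitsEquivAut ℝ (Units.mk0 _ hX0) : ℝ →L[ℝ] ℝ) x :=
    (hX.differentiableAt (by simp)).hasDerivAt.hasFDerivAt_equiv hX0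
  have h2 : ContDiffAt ℝ ∞ (hX.localInverse hd (by simp)) (X x) :=
    hX.to_localInverse hd (by simp)
  have h3 : hX.localInverse hd (by simp) (X x) = x := hX.localInverse_apply_image hd (by simp)
  have h4 := (hX.hasStrictFDerivAt' hd (by simp)).eventually_right_inverse
  have h5 : ContDiffAt ℝ ∞ (fun y => φ (hX.localInverse hd (by simp) y)) (X x) :=
    ContDiffAt.comp (X x) (by rwa [h3]) h2
  refine h5.congr_of_eventuallyEq ?_
  have h6 : Tendsto (hX.localInverse hd (by simp)) (𝓝 (X x)) (𝓝 x) := by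
    have := h2.continuousAt.tendsto
    rwa [h3] at this
  filter_upwards [h4, h6.eventually h] with y hy hy'
  rw [← hy']
  exact congrArg F hy.symm

/-! ### Sufficiency of the formulas -/

section

variable {T I J : Set ℝ} {Φ : ℝ × ℝ × ℝ → ℝ × ℝ × ℝ} {Θ : Elements → Elements}
  {d : VarParams} {θ θ' : Elements} {ε₁ ε₂ ε₃ ε₄ : ℝ}

theorem isPointTransformation_of_eqOn (hI : IsOpen I) (hB : IsOpen (box T I J))
    (hd : d.Admissible I) (hform : EqOn Φ d.map (box T I J)) : IsPointTransformation T I J Φ := by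
  obtain ⟨hδ, hX, hX0⟩ := hd
  constructor
  · refine ContDiffOn.congr ?_ hform
    have h1 : ContDiffOn ℝ ∞ (fun z : ℝ × ℝ × ℝ => z.2.1) (box T I J) := by fun_prop
    have h2 : ContDiffOn ℝ ∞ (fun z : ℝ × ℝ × ℝ => d.δ₁ * z.1 + d.δ₂) (box T I J) := by fun_prop
    have h3 : ContDiffOn ℝ ∞ (fun z : ℝ × ℝ × ℝ => d.δ₃ * z.2.2 + d.δ₄) (box T I J) := by fun_prop
    exact h2.prodMk ((hX.comp h1 fun z hz => hz.2.1).prodMk h3)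
  · intro z hz
    have e : Φ =ᶠ[𝓝 z] d.map := by
      filter_upwards [hB.mem_nhds hz] with y hy using hform hy
    have hXd : HasDerivAt d.X (deriv d.X z.2.1) z.2.1 :=
      ((hX.contDiffAt (hI.mem_nhds hz.2.1)).differentiableAt (by simp)).hasDerivAt
    have h1 := (coord₁.hasFDerivAt (x := z)).const_mul d.δ₁ |>.add_const d.δ₂
    have h2 := hXd.comp_hasFDerivAt z (coord₂.hasFDerivAt (x := z))
    have h3 := (fiberProj.hasFDerivAt (x := z)).const_mul d.δ₃ |>.add_const d.δ₄
    have h4 : HasFDerivAt d.map _ z := h1.prodMk (h2.prodMk h3)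
    rw [e.fderiv_eq, h4.fderiv]
    intro h0
    have hk := LinearMap.bot_lt_ker_of_det_eq_zero h0
    refine hk.ne' (LinearMap.ker_eq_bot'.2 fun y hy => ?_)
    have e1 : d.δ₁ * y.1 = 0 := congrArg Prod.fst hy
    have e2 : deriv d.X z.2.1 * y.2.1 = 0 := congrArg (fun y => y.2.1) hy
    have e3 : d.δ₃ * y.2.2 = 0 := congrArg (fun y => y.2.2) hy
    exact Prod.ext ((mul_eq_zero.1 e1).resolve_left (left_ne_zero_of_mul hδ))
      (Prod.ext ((mul_eq_zero.1 e2).resolve_left (hX0 _ hz.2.1))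
        ((mul_eq_zero.1 e3).resolve_left (right_ne_zero_of_mul hδ)))

theorem mem_xImage (hform : EqOn Φ d.map (box T I J)) {y : ℝ} (hy : y ∈ xImage T I J Φ) :
    ∃ x ∈ I, d.X x = y := by
  obtain ⟨z, hz, rfl⟩ := hy
  exact ⟨z.2.1, hz.2.1, by simp only [hform hz]; rfl⟩

theorem mem_uImage (hform : EqOn Φ d.map (box T I J)) {y : ℝ} (hy : y ∈ uImage T I J Φ) :
    ∃ u ∈ J, d.δ₃ * u + d.δ₄ = y := by
  obtain ⟨z, hz, rfl⟩ := hy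
  exact ⟨z.2.2, hz.2.2, by simp only [hform hz]; rfl⟩

/-- The smoothness of the new arbitrary elements. -/
theorem ElementsTransformed.contDiffAt (hI : IsOpen I) (hJ : IsOpen J) (hd : d.Admissible I)
    (hθ : θ ∈ classOn I J) (h : ElementsTransformed I J d ε₁ ε₂ ε₃ ε₄ θ θ') :
    (∀ x ∈ I, ContDiffAt ℝ ∞ θ'.f (d.X x) ∧ ContDiffAt ℝ ∞ θ'.g (d.X x) ∧
      ContDiffAt ℝ ∞ θ'.h (d.X x)) ∧
    ∀ u ∈ J, ContDiffAt ℝ ∞ θ'.H (d.δ₃ * u + d.δ₄) ∧ ContDiffAt ℝ ∞ θ'.K (d.δ₃ * u + d.δ₄) := by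
  obtain ⟨P, hP, hf, hg, hh, hH, hK⟩ := h
  obtain ⟨cf, cg, ch, cH, cK, f0, g0, H0, hnl⟩ := hθ
  obtain ⟨hδ, hX, hX0⟩ := hd
  have hPc : ContDiffOn ℝ ∞ P I := by
    refine (contDiffOn_infty_iff_deriv_of_isOpen hI).2
      ⟨fun x hx => (hP x hx).differentiableAt.differentiableWithinAt, ?_⟩
    exact (ch.div cg g0).congr fun x hx => (hP x hx).deriv
  have hexp : ContDiffOn ℝ ∞ (fun x => Real.exp (-ε₄ * P x)) I :=
    Real.contDiff_exp.comp_contDiffOn (contDiffOn_const.mul hPc)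
  have hX' : ContDiffOn ℝ ∞ (deriv d.X) I := ((contDiffOn_infty_iff_deriv_of_isOpen hI).1 hX).2
  have key : ∀ {F φ : ℝ → ℝ}, ContDiffOn ℝ ∞ φ I → (∀ x ∈ I, F (d.X x) = φ x) →
      ∀ x ∈ I, ContDiffAt ℝ ∞ F (d.X x) := by
    intro F φ hφ hF x hx
    refine contDiffAt_of_comp (hX.contDiffAt (hI.mem_nhds hx)) (hX0 x hx)
      (hφ.contDiffAt (hI.mem_nhds hx)) ?_
    filter_upwards [hI.mem_nhds hx] with y hy using hF y hy
  have key' : ∀ {F φ : ℝ → ℝ}, ContDiffOn ℝ ∞ φ J → (∀ u ∈ J, F (d.δ₃ * u + d.δ₄) = φ u) →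
      ∀ u ∈ J, ContDiffAt ℝ ∞ F (d.δ₃ * u + d.δ₄) := by
    intro F φ hφ hF u hu
    refine contDiffAt_of_comp (X := fun u => d.δ₃ * u + d.δ₄) (by fun_prop)
      (by rw [deriv_affine]; exact right_ne_zero_of_mul hδ) (hφ.contDiffAt (hJ.mem_nhds hu)) ?_
    filter_upwards [hJ.mem_nhds hu] with y hy using hF y hy
  exact ⟨fun x hx => ⟨key (((contDiffOn_const.div hX' hX0).mul cf).mul hexp) hf x hx,
    key (((contDiffOn_const.mul hX').mul cg).mul hexp) hg x hx,
    key ((contDiffOn_const.mul ch).mul hexp) hh x hx⟩,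
    fun u hu => ⟨key' (contDiffOn_const.mul cH) hH u hu,
      key' (contDiffOn_const.mul (cK.add (contDiffOn_const.mul cH))) hK u hu⟩⟩

theorem hasDerivAt_of_comp_affine {F : ℝ → ℝ} {a b c w : ℝ} (ha : a ≠ 0)
    (hF : DifferentiableAt ℝ F (a * w + b)) (h : HasDerivAt (fun u => F (a * u + b)) c w) :
    deriv F (a * w + b) = c / a := by
  have h1 : HasDerivAt (fun u : ℝ => a * u + b) a w := by
    simpa using ((hasDerivAt_id w).const_mul a).add_const b
  exact eq_div_of_mul_eq ha ((hF.hasDerivAt.comp w h1).unique h)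

theorem ElementsTransformed.deriv_HK (hJ : IsOpen J) (hI : IsOpen I) (hd : d.Admissible I)
    (hθ : θ ∈ classOn I J) (h : ElementsTransformed I J d ε₁ ε₂ ε₃ ε₄ θ θ') {u : ℝ} (hu : u ∈ J) :
    deriv θ'.H (d.δ₃ * u + d.δ₄) = ε₂ * deriv θ.H u / d.δ₃ ∧
      deriv θ'.K (d.δ₃ * u + d.δ₄) = ε₃ * (deriv θ.K u + ε₄ * deriv θ.H u) / d.δ₃ := by
  obtain ⟨h1, h2⟩ := (h.contDiffAt hI hJ hd hθ).2 u hu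
  obtain ⟨P, hP, hf, hg, hh, hH, hK⟩ := h
  have hδ₃ : d.δ₃ ≠ 0 := right_ne_zero_of_mul hd.1
  have dH := ((hθ.2.2.2.1.contDiffAt (hJ.mem_nhds hu)).differentiableAt (by simp)).hasDerivAt
  have dK := ((hθ.2.2.2.2.1.contDiffAt (hJ.mem_nhds hu)).differentiableAt (by simp)).hasDerivAt
  constructor
  · refine hasDerivAt_of_comp_affine hδ₃ (h1.differentiableAt (by simp))
      ((dH.const_mul ε₂).congr_of_eventuallyEq ?_)
    filter_upwards [hJ.mem_nhds hu] with w hw using hH w hw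
  · refine hasDerivAt_of_comp_affine hδ₃ (h2.differentiableAt (by simp))
      (((dK.add (dH.const_mul ε₄)).const_mul ε₃).congr_of_eventuallyEq ?_)
    filter_upwards [hJ.mem_nhds hu] with w hw using hK w hw

theorem ElementsTransformed.mem_classOn (hne : (box T I J).Nonempty) (hI : IsOpen I)
    (hJ : IsOpen J) (hd : d.Admissible I) (hform : EqOn Φ d.map (box T I J))
    (hε : ε₁ * ε₂ * ε₃ ≠ 0) (hθ : θ ∈ classOn I J)
    (h : ElementsTransformed I J d ε₁ ε₂ ε₃ ε₄ θ θ') :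
    θ' ∈ classOn (xImage T I J Φ) (uImage T I J Φ) := by
  obtain ⟨c1, c2⟩ := h.contDiffAt hI hJ hd hθ
  have hder := fun u hu => h.deriv_HK hJ hI hd hθ (u := u) hu
  obtain ⟨P, hP, hf, hg, hh, hH, hK⟩ := h
  obtain ⟨cf, cg, ch, cH, cK, f0, g0, H0, u₁, hu₁, hnl⟩ := hθ
  have hε₁ : ε₁ ≠ 0 := left_ne_zero_of_mul (left_ne_zero_of_mul hε)
  have hε₂ : ε₂ ≠ 0 := right_ne_zero_of_mul (left_ne_zero_of_mul hε)
  have hε₃ : ε₃ ≠ 0 := right_ne_zero_of_mul hε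
  have hδ₁ : d.δ₁ ≠ 0 := left_ne_zero_of_mul hd.1
  have hδ₃ : d.δ₃ ≠ 0 := right_ne_zero_of_mul hd.1
  refine ⟨?_, ?_, ?_, ?_, ?_, ?_, ?_, ?_, ?_⟩
  · intro y hy
    obtain ⟨x, hx, rfl⟩ := mem_xImage hform hy
    exact (c1 x hx).1.contDiffWithinAt
  · intro y hy
    obtain ⟨x, hx, rfl⟩ := mem_xImage hform hy
    exact (c1 x hx).2.1.contDiffWithinAt
  · intro y hy
    obtain ⟨x, hx, rfl⟩ := mem_xImage hform hy
    exact (c1 x hx).2.2.contDiffWithinAt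
  · intro y hy
    obtain ⟨u, hu, rfl⟩ := mem_uImage hform hy
    exact (c2 u hu).1.contDiffWithinAt
  · intro y hy
    obtain ⟨u, hu, rfl⟩ := mem_uImage hform hy
    exact (c2 u hu).2.contDiffWithinAt
  · intro y hy
    obtain ⟨x, hx, rfl⟩ := mem_xImage hform hy
    rw [hf x hx]
    exact mul_ne_zero (mul_ne_zero (div_ne_zero (mul_ne_zero hε₁ (pow_ne_zero 2 hδ₁))
      (hd.2.2 x hx)) (f0 x hx)) (Real.exp_ne_zero _)
  · intro y hy
    obtain ⟨x, hx, rfl⟩ := mem_xImage hform hy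
    rw [hg x hx]
    exact mul_ne_zero (mul_ne_zero (mul_ne_zero (mul_ne_zero hε₁ (inv_ne_zero hε₂))
      (hd.2.2 x hx)) (g0 x hx)) (Real.exp_ne_zero _)
  · intro y hy
    obtain ⟨u, hu, rfl⟩ := mem_uImage hform hy
    rw [hH u hu]
    exact mul_ne_zero hε₂ (H0 u hu)
  · obtain ⟨⟨t, x, u⟩, ht, hx, hu⟩ := hne
    have hz : (t, x, u₁) ∈ box T I J := ⟨ht, hx, hu₁⟩
    refine ⟨d.δ₃ * u₁ + d.δ₄, ⟨_, hz, by simp only [hform hz]; rfl⟩, ?_⟩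
    rw [(hder u₁ hu₁).1, (hder u₁ hu₁).2]
    -- If the derivative of `H` vanishes at `u₁`, the summand with `ε₄` drops out of the derivative
    -- of the new `K`, and nonlinearity is inherited from `K`.
    by_cases h0 : deriv θ.H u₁ = 0
    · right
      rw [h0, mul_zero, add_zero]
      exact div_ne_zero (mul_ne_zero hε₃ (hnl.resolve_left (not_not_intro h0))) hδ₃
    · exact Or.inl (div_ne_zero (mul_ne_zero hε₂ h0) hδ₃)

/-- Differentiating the exponential in the new `g` produces a term `-ε₄ h H u_x`, up to a common
factor, which cancels exactly the summand `ε₄ H` of the new `K`. -/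
theorem ElementsTransformed.transformsEquation (hI : IsOpen I)
    (hJ : IsOpen J) (hB : IsOpen (box T I J)) (hd : d.Admissible I)
    (hform : EqOn Φ d.map (box T I J)) (hε : ε₁ * ε₂ * ε₃ ≠ 0) (hθ : θ ∈ classOn I J)
    (h : ElementsTransformed I J d ε₁ ε₂ ε₃ ε₄ θ θ') : TransformsEquation T I J Φ θ θ' := by
  intro u v p hpT hpI hpJ hu hdet hv hvτ
  obtain ⟨c1, c2⟩ := h.contDiffAt hI hJ hd hθ
  obtain ⟨t, x⟩ := p
  simp only at hpT hpI
  have hder := (h.deriv_HK hJ hI hd hθ hpJ).1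
  obtain ⟨P, hP, hf, hg, hh, hH, hK⟩ := h
  have hε₁ : ε₁ ≠ 0 := left_ne_zero_of_mul (left_ne_zero_of_mul hε)
  have hε₂ : ε₂ ≠ 0 := right_ne_zero_of_mul (left_ne_zero_of_mul hε)
  have hε₃ : ε₃ ≠ 0 := right_ne_zero_of_mul hε
  have hδ₁ : d.δ₁ ≠ 0 := left_ne_zero_of_mul hd.1
  have hδ₃ : d.δ₃ ≠ 0 := right_ne_zero_of_mul hd.1
  have hX0 := hd.2.2 x hpI
  have hXd : ContDiffAt ℝ 2 d.X x := (hd.2.1.contDiffAt (hI.mem_nhds hpI)).of_le two_le_infty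
  have hgd : HasDerivAt θ.g (deriv θ.g x) x :=
    ((hθ.2.1.contDiffAt (hI.mem_nhds hpI)).differentiableAt (by simp)).hasDerivAt
  have hHd : DifferentiableAt ℝ θ.H (u (t, x)) :=
    (hθ.2.2.2.1.contDiffAt (hJ.mem_nhds hpJ)).differentiableAt (by simp)
  have hgd' := (c1 x hpI).2.1.differentiableAt (by simp)
  have hHd' := (c2 _ hpJ).1.differentiableAt (by simp)
  have hg0 := hθ.2.2.2.2.2.2.1 x hpI
  have e : deriv θ'.g (d.X x) = (ε₁ * ε₂⁻¹ * deriv (deriv d.X) x * θ.g x +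
      ε₁ * ε₂⁻¹ * deriv d.X x * deriv θ.g x - ε₄ * ε₁ * ε₂⁻¹ * deriv d.X x * θ.h x) *
        Real.exp (-ε₄ * P x) / deriv d.X x := by
    refine eq_div_of_mul_eq hX0 ?_
    have h1 := (((differentiableAt_deriv hXd).hasDerivAt.const_mul (ε₁ * ε₂⁻¹)).mul hgd).mul
      ((hP x hpI).const_mul (-ε₄)).exp
    have h2 := (hgd'.hasDerivAt.comp x (hXd.differentiableAt (by norm_num)).hasDerivAt).unique
      (h1.congr_of_eventuallyEq (by filter_upwards [hI.mem_nhds hpI] with y hy using hg y hy))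
    rw [h2]
    simp only [Pi.mul_apply]
    field_simp
    ring
  rw [holdsAt_iff hu hgd.differentiableAt hHd,
    special_holdsAt (μ := fun u => d.δ₃ * u + d.δ₄) hB (fun z hz => hform hz)
      (p := (t, x)) ⟨hpT, hpI, hpJ⟩ hu hXd (by fun_prop) hv hvτ hδ₁ hX0 hgd' hHd',
    deriv_deriv_affine, deriv_affine, hder]
  simp only [e, hf x hpI, hg x hpI, hh x hpI, hH _ hpJ, hK _ hpJ]
  -- The new equation, written in the old jet, is the old one multiplied by this factor.
  have hk : ε₁ * d.δ₃ * Real.exp (-ε₄ * P x) / deriv d.X x ≠ 0 :=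
    div_ne_zero (mul_ne_zero (mul_ne_zero hε₁ hδ₃) (Real.exp_ne_zero _)) hX0
  rw [← mul_right_inj' hk]
  refine Eq.congr ?_ ?_
  · field_simp
    ring
  · field_simp
    ring

/-- The transformations of the stated form are extended equivalence transformations. -/
theorem isExtendedEquivalence_of_elementsTransformed {S : Set Elements} (hS : S ⊆ classOn I J)
    (hne : (box T I J).Nonempty) (hI : IsOpen I) (hJ : IsOpen J) (hB : IsOpen (box T I J))
    (hd : d.Admissible I) (hform : EqOn Φ d.map (box T I J))
    (h : ∀ θ ∈ S, ∃ ε₁ ε₂ ε₃ ε₄ : ℝ, ε₁ * ε₂ * ε₃ ≠ 0 ∧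
      ElementsTransformed I J d ε₁ ε₂ ε₃ ε₄ θ (Θ θ)) :
    IsExtendedEquivalence T I J S Φ Θ := by
  refine ⟨isPointTransformation_of_eqOn hI hB hd hform, fun θ hθ => ?_⟩
  obtain ⟨ε₁, ε₂, ε₃, ε₄, hε, ht⟩ := h θ hθ
  exact ⟨ht.mem_classOn hne hI hJ hd hform hε (hS hθ),
    ht.transformsEquation hI hJ hB hd hform hε (hS hθ)⟩

/-! ### Existence of the separated rule -/

theorem injOn_of_deriv_ne_zero (hI' : IsPreconnected I) {X : ℝ → ℝ}
    (hX : DifferentiableOn ℝ X I) (h0 : ∀ x ∈ I, deriv X x ≠ 0) : InjOn X I := by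
  have key : ∀ x ∈ I, ∀ y ∈ I, x < y → X x ≠ X y := by
    intro x hx y hy hxy h
    have hsub := hI'.ordConnected.out hx hy
    obtain ⟨c, hc, hc'⟩ := exists_deriv_eq_zero hxy (hX.continuousOn.mono hsub) h
    exact h0 c (hsub (Ioo_subset_Icc_self hc)) hc'
  intro x hx y hy h
  rcases lt_trichotomy x y with hl | hl | hl
  · exact absurd h (key x hx y hy hl)
  · exact hl
  · exact absurd h.symm (key y hy x hx hl)

/-- The rule given by the formulas, with constants common to all equations. -/
theorem exists_separated_rule (hI : IsOpen I) (hI' : IsConnected I) (T J : Set ℝ)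
    (hd : d.Admissible I) (ε₁ ε₂ ε₃ ε₄ : ℝ) :
    ∃ Θ : Elements → Elements, IsSeparated T I J d.map Θ ∧
      ∀ θ ∈ classOn I J, ElementsTransformed I J d ε₁ ε₂ ε₃ ε₄ θ (Θ θ) := by
  obtain ⟨x₀, hx₀⟩ := hI'.nonempty
  have hδ₃ : d.δ₃ ≠ 0 := right_ne_zero_of_mul hd.1
  have hinv : ∀ x ∈ I, Function.invFunOn d.X I (d.X x) = x :=
    (injOn_of_deriv_ne_zero hI'.isPreconnected (hd.2.1.differentiableOn (by simp))
      hd.2.2).leftInvOn_invFunOn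
  have hinv' : ∀ u : ℝ, (d.δ₃ * u + d.δ₄ - d.δ₄) / d.δ₃ = u := fun u => by field_simp; ring
  -- The formulas are pulled back along the inverses of `X` and of the affine map. The common base
  -- point `x₀` of the integrals makes the rule depend only on the arbitrary elements.
  refine ⟨fun θ =>
    { f := fun y => ε₁ * d.δ₁ ^ 2 / deriv d.X (Function.invFunOn d.X I y) *
        θ.f (Function.invFunOn d.X I y) *
          Real.exp (-ε₄ * ∫ s in x₀..Function.invFunOn d.X I y, θ.h s / θ.g s)
      g := fun y => ε₁ * ε₂⁻¹ * deriv d.X (Function.invFunOn d.X I y) *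
        θ.g (Function.invFunOn d.X I y) *
          Real.exp (-ε₄ * ∫ s in x₀..Function.invFunOn d.X I y, θ.h s / θ.g s)
      h := fun y => ε₁ * ε₃⁻¹ * θ.h (Function.invFunOn d.X I y) *
          Real.exp (-ε₄ * ∫ s in x₀..Function.invFunOn d.X I y, θ.h s / θ.g s)
      H := fun v => ε₂ * θ.H ((v - d.δ₄) / d.δ₃)
      K := fun v => ε₃ * (θ.K ((v - d.δ₄) / d.δ₃) + ε₄ * θ.H ((v - d.δ₄) / d.δ₃)) },
    fun θ₁ _ θ₂ _ => ⟨fun hf hg hh => ?_, fun hH hK => ?_⟩, fun θ hθ => ?_⟩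
  · have hint : ∀ x ∈ I, (∫ s in x₀..x, θ₁.h s / θ₁.g s) = ∫ s in x₀..x, θ₂.h s / θ₂.g s := by
      intro x hx
      -- The segment from `x₀` to `x` lies in `I`, so the values of `g` and `h` outside `I` do not
      -- matter.
      refine intervalIntegral.integral_congr fun s hs => ?_
      have hsI := hI'.isPreconnected.ordConnected.uIcc_subset hx₀ hx hs
      simp only [hg hsI, hh hsI]
    refine ⟨fun y hy => ?_, fun y hy => ?_, fun y hy => ?_⟩ <;>
      obtain ⟨x, hx, rfl⟩ := mem_xImage (fun _ _ => rfl) hy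
    · simp only [hinv x hx, hf hx, hint x hx]
    · simp only [hinv x hx, hg hx, hint x hx]
    · simp only [hinv x hx, hh hx, hint x hx]
  · refine ⟨fun y hy => ?_, fun y hy => ?_⟩ <;>
      obtain ⟨u, hu, rfl⟩ := mem_uImage (fun _ _ => rfl) hy
    · simp only [hinv', hH hu]
    · simp only [hinv', hH hu, hK hu]
  · refine ⟨fun x => ∫ s in x₀..x, θ.h s / θ.g s, fun x hx => hasDerivAt_integral hI
      hI'.isPreconnected (continuousOn_ratio hθ) hx₀ hx, fun x hx => ?_, fun x hx => ?_,
      fun x hx => ?_, fun u _ => ?_, fun u _ => ?_⟩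
    · simp only [hinv x hx]
    · simp only [hinv x hx]
    · simp only [hinv x hx]
    · simp only [hinv']
    · simp only [hinv']

end

end Telegraph

/-! ### The main theorem -/

theorem mainTheorem5 (T I J : Set ℝ) (hT : IsOpen T) (hT' : IsConnected T)
    (hI : IsOpen I) (hI' : IsConnected I) (hJ : IsOpen J) (hJ' : IsConnected J) :
    -- every choice of the parameters occurs, with constants common to the whole class
    (∀ (d : Telegraph.VarParams) (ε₁ ε₂ ε₃ ε₄ : ℝ), d.Admissible I → ε₁ * ε₂ * ε₃ ≠ 0 →
      ∃ Θ : Telegraph.Elements → Telegraph.Elements,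
        Telegraph.IsSeparated T I J d.map Θ ∧
        ∀ θ ∈ Telegraph.classOn I J,
          Telegraph.ElementsTransformed I J d ε₁ ε₂ ε₃ ε₄ θ (Θ θ)) ∧
    -- all transformations of the stated form are extended equivalence transformations
    (∀ (d : Telegraph.VarParams) (Φ : ℝ × ℝ × ℝ → ℝ × ℝ × ℝ)
      (Θ : Telegraph.Elements → Telegraph.Elements), d.Admissible I →
      EqOn Φ d.map (Telegraph.box T I J) →
      (∀ θ ∈ Telegraph.classOn I J, ∃ ε₁ ε₂ ε₃ ε₄ : ℝ, ε₁ * ε₂ * ε₃ ≠ 0 ∧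
        Telegraph.ElementsTransformed I J d ε₁ ε₂ ε₃ ε₄ θ (Θ θ)) →
      Telegraph.IsExtendedEquivalence T I J (Telegraph.classOn I J) Φ Θ) ∧
    -- there are no others, for arbitrary elements in general position
    (∀ (Φ : ℝ × ℝ × ℝ → ℝ × ℝ × ℝ) (Θ : Telegraph.Elements → Telegraph.Elements),
      Telegraph.IsExtendedEquivalence T I J (Telegraph.genericOn I J) Φ Θ ↔
        ∃ d : Telegraph.VarParams, d.Admissible I ∧ EqOn Φ d.map (Telegraph.box T I J) ∧
          ∀ θ ∈ Telegraph.genericOn I J, ∃ ε₁ ε₂ ε₃ ε₄ : ℝ, ε₁ * ε₂ * ε₃ ≠ 0 ∧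
            Telegraph.ElementsTransformed I J d ε₁ ε₂ ε₃ ε₄ θ (Θ θ)) ∧
    -- for separated rules there are no others on the whole class, and `ε₂`, `ε₃`, `ε₄` do not
    -- depend on the equation (`ε₁` absorbs the constant of integration)
    (∀ (Φ : ℝ × ℝ × ℝ → ℝ × ℝ × ℝ) (Θ : Telegraph.Elements → Telegraph.Elements),
      Telegraph.IsSeparated T I J Φ Θ →
      (Telegraph.IsExtendedEquivalence T I J (Telegraph.classOn I J) Φ Θ ↔
        ∃ (d : Telegraph.VarParams) (ε₂ ε₃ ε₄ : ℝ), d.Admissible I ∧ ε₂ * ε₃ ≠ 0 ∧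
          EqOn Φ d.map (Telegraph.box T I J) ∧
          ∀ θ ∈ Telegraph.classOn I J, ∃ ε₁ : ℝ, ε₁ ≠ 0 ∧
            Telegraph.ElementsTransformed I J d ε₁ ε₂ ε₃ ε₄ θ (Θ θ))) := by
  have hB := Telegraph.isOpen_box hT hI hJ
  have hne : (Telegraph.box T I J).Nonempty :=
    hT'.nonempty.prod (hI'.nonempty.prod hJ'.nonempty)
  refine ⟨fun d ε₁ ε₂ ε₃ ε₄ hd _ => Telegraph.exists_separated_rule hI hI' T J hd ε₁ ε₂ ε₃ ε₄,
    fun d Φ Θ hd hform h => Telegraph.isExtendedEquivalence_of_elementsTransformed subset_rfl hne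
      hI hJ hB hd hform h, fun Φ Θ => ⟨fun hE => ?_, ?_⟩, fun Φ Θ hs => ⟨fun hE => ?_, ?_⟩⟩
  · obtain ⟨d, hd, hform⟩ := Telegraph.exists_varParams hT hT'.isPreconnected hI
      hI'.isPreconnected hJ hJ'.isPreconnected hne hE
    refine ⟨d, hd, hform, fun θ hθ => ?_⟩
    obtain ⟨ε₂, E, h⟩ := Telegraph.exists_elementsRelated hT hI hJ hne hE.1 hd hform hθ.1
      (hE.2 θ hθ).1 (hE.2 θ hθ).2
    exact Telegraph.generic_elementsTransformed hI hI' hθ h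
  · rintro ⟨d, hd, hform, h⟩
    exact Telegraph.isExtendedEquivalence_of_elementsTransformed (fun _ hθ => hθ.1) hne hI hJ hB
      hd hform h
  -- The form of `Φ` already follows from the generic subclass; separatedness is needed only for the
  -- arbitrary elements.
  · obtain ⟨d, hd, hform⟩ := Telegraph.exists_varParams hT hT'.isPreconnected hI
      hI'.isPreconnected hJ hJ'.isPreconnected hne
      (Θ := Θ) ⟨hE.1, fun θ hθ => hE.2 θ hθ.1⟩
    obtain ⟨ε₂, ε₃, ε₄, hε, h⟩ :=
      Telegraph.separated_elementsTransformed hT hI hI' hJ hne hd hform hs hE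
    exact ⟨d, ε₂, ε₃, ε₄, hd, hε, hform, h⟩
  · rintro ⟨d, ε₂, ε₃, ε₄, hd, hε, hform, h⟩
    refine Telegraph.isExtendedEquivalence_of_elementsTransformed subset_rfl hne hI hJ hB hd hform
      fun θ hθ => ?_
    obtain ⟨ε₁, h1, h2⟩ := h θ hθ
    exact ⟨ε₁, ε₂, ε₃, ε₄, by rw [mul_assoc]; exact mul_ne_zero h1 hε, h2⟩
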